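/- **Setting.** Let $V=\{x\in H^1(0,1):\int_0^1x(\xi)\,d\xi=0\}$ with $\langle x,y\rangle_V=\int_0^1x'y'\,d\xi$, and let $H$ be the dual space of $V$ with the dual norm. For $p\ge 1$ let $\widetilde L^p(0,1)$ be the set of $x\in L^p(0,1)$ with zero mean; it is regarded as a subset of $H$ by identifying $x$ with the functional $y\mapsto\int_0^1x(\xi)y(\xi)\,d\xi$, and in particular $V\subset H$. Let $B:V\to H$, $Bx(y)=\int_0^1x'y'\,d\xi$, and let $A=-B^2$ as an operator in $H$, that is, $D(A)=\{x\in V: Bx\in V\}$. Let $\mu$ be the Gaussian measure on $H$ with mean $0$ and covariance $Q=-\tfrac12A^{-1}=\tfrac12B^{-2}$. For $k\ge 1$ put $f_k(\xi)=k\pi\sqrt2\cos(k\pi\xi)$; the $f_k$ form an orthonormal basis of $H$ and $Qf_k=\lambda_kf_k$ with $\lambda_k=\frac1{2\pi^4k^4}$. Let $P_nx=\sum_{k=1}^n\langle x,f_k\rangle_Hf_k$. Let $\mathcal{FC}^1_b(H)$ be the set of functions $x\mapsto\phi(\langle x,f_1\rangle_H,\dots,\langle x,f_n\rangle_H)$ with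 $n\in\mathbb N$ and $\phi\in C^1_b(\mathbb R^n)$. For $1\le p<\infty$, $W^{1,p}_{1/2}(H,\mu)$ is the domain of the closure $Q^{1/2}D$ in $L^p(H,\mu)$ of the operator $\varphi\mapsto Q^{1/2}D\varphi\in L^p(H,\mu;H)$ defined on $\mathcal{FC}^1_b(H)$, where $D\varphi$ is the gradient of $\varphi$. For $u\in W^{1,p}_{1/2}(H,\mu)$ put $D_ku=\lambda_k^{-1/2}\langle Q^{1/2}Du,f_k\rangle_H$. **Hypothesis.** Let $\Phi:\mathbb R\to\mathbb R$ be convex, of class $C^1$ and bounded from below, and suppose that $|\Phi'(t)|\le C(1+|t|^{p_2})$ for all $t\in\mathbb R$, for some $C>0$ and $p_2\ge1$, and that $\lim_{r\to\pm\infty}\Phi(r)/|r|=+\infty$. Put $p_1=p_2+1$ and $$U(x)=\int_0^1\Phi(x(\xi))\,d\xi\ \text{ if }x\in\widetilde L^{p_1}(0,1),\qquad U(x)=+\infty\ \text{ if }x\in H\setminus\widetilde L^{p_1}(0,1),$$ $$U_n(x)=U(P_nx)=\int_0^1\Phi(P_nx(\xi))\,d\xi,\qquad x\in H,\ n\in\mathbb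 N .$$ **Proposition.** $U$ is finite $\mu$-a.e., and for every $p\in[1,\infty)$ one has $U\in W^{1,p}_{1/2}(H,\mu)$, $U_n\in L^p(H,\mu)$ for all $n$, and $U_n\to U$ in $L^p(H,\mu)$ as $n\to\infty$. Moreover, for every $k\ge1$ and for $\mu$-a.e. $x\in H$, the function $\xi\mapsto\Phi'(x(\xi))f_k(\xi)$ is integrable on $(0,1)$ and $$D_kU(x)=\int_0^1\Phi'(x(\xi))f_k(\xi)\,d\xi .$$ -/

import Mathlib

open MeasureTheory ProbabilityTheory Set Filter Topology
open scoped ENNReal ContDiff InnerProductSpace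

namespace CahnHilliard

noncomputable section

/-! ### The space of mean-zero `H¹` functions on the unit interval -/

/-- Lebesgue measure on the interval `(0, 1)`. -/
abbrev vol01 : Measure ℝ := volume.restrict (Ioo (0 : ℝ) 1)

instance : IsProbabilityMeasure vol01 := ⟨by simp⟩

/-- `v` is the weak derivative of `u` on `(0, 1)`: `∫ u φ' = - ∫ v φ` for every test function
`φ ∈ C_c^∞(0, 1)`. -/
def IsWeakDeriv (u v : ℝ → ℝ) : Prop :=
  ∀ φ : ℝ → ℝ, ContDiff ℝ ∞ φ → HasCompactSupport φ → tsupport φ ⊆ Ioo 0 1 →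
    ∫ ξ, u ξ * deriv φ ξ ∂vol01 = - ∫ ξ, v ξ * φ ξ ∂vol01

/-- The Lebesgue space `L²(0, 1)`. -/
abbrev L2 : Type := Lp ℝ 2 vol01

theorem integrable_mul_test {u φ : ℝ → ℝ} (hu : Integrable u vol01) (hφ : Continuous φ)
    (hc : HasCompactSupport φ) : Integrable (fun ξ => u ξ * φ ξ) vol01 := by
  obtain ⟨C, hC⟩ := hc.exists_bound_of_continuous hφ
  exact hu.mul_bdd (c := C) hφ.aestronglyMeasurable (Eventually.of_forall hC)

theorem integrable_L2 (u : L2) : Integrable u vol01 :=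
  (Lp.memLp u).integrable (by norm_num)

theorem integral_vol01 (f : ℝ → ℝ) : ∫ ξ, f ξ ∂vol01 = ∫ ξ in (0 : ℝ)..1, f ξ := by
  rw [intervalIntegral.integral_of_le zero_le_one, integral_Ioc_eq_integral_Ioo]

theorem intervalIntegrable_of_vol01 {v : ℝ → ℝ} (hv : Integrable v vol01) :
    IntervalIntegrable v volume 0 1 := by
  rw [intervalIntegrable_iff_integrableOn_Ioo_of_le zero_le_one]
  exact hv

/-- The primitive of an integrable function has that function as its weak derivative. -/
theorem isWeakDeriv_primitive {v : ℝ → ℝ} (hv : Integrable v vol01) :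
    IsWeakDeriv (fun x => ∫ t in (0 : ℝ)..x, v t) v := by
  intro φ hφ hc hs
  have hvi := intervalIntegrable_of_vol01 hv
  have hw := hvi.absolutelyContinuousOnInterval_intervalIntegral (c := 0) (by simp)
  have hφa : AbsolutelyContinuousOnInterval φ 0 1 :=
    (hφ.of_le (by simp)).contDiffOn.absolutelyContinuousOnInterval
  have h0 : φ 0 = 0 := image_eq_zero_of_notMem_tsupport (fun h => by simpa using (hs h).1)
  have h1 : φ 1 = 0 := image_eq_zero_of_notMem_tsupport (fun h => by simpa using (hs h).2)
  rw [integral_vol01, integral_vol01, hw.integral_mul_deriv_eq_deriv_mul hφa, h0, h1]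
  simp only [mul_zero, sub_zero, zero_sub, neg_inj]
  apply intervalIntegral.integral_congr_ae
  filter_upwards [hvi.ae_hasDerivAt_integral] with x hx hx'
  rw [(hx (uIoc_subset_uIcc hx') 0 (by simp)).deriv]

/-- An integrable function with zero weak derivative is constant. -/
theorem ae_eq_const_of_weakDeriv_zero {u : ℝ → ℝ} (hu : Integrable u vol01)
    (h : IsWeakDeriv u (fun _ => 0)) : ∃ c : ℝ, u =ᵐ[vol01] fun _ => c := by
  let b : ContDiffBump (1 / 2 : ℝ) := ⟨1 / 8, 1 / 4, by norm_num, by norm_num⟩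
  set η : ℝ → ℝ := b.normed volume with hη
  have hηd : ContDiff ℝ ∞ η := b.contDiff_normed
  have hηc : HasCompactSupport η := b.hasCompactSupport_normed
  have hηs : tsupport η ⊆ Ioo 0 1 := by
    rw [hη, b.tsupport_normed_eq, Real.closedBall_eq_Icc]
    intro x hx
    simp only [b] at hx
    constructor <;> [have := hx.1; have := hx.2] <;> norm_num at this ⊢ <;> linarith
  have hηi : ∫ ξ, η ξ ∂vol01 = 1 := by
    rw [setIntegral_eq_integral_of_forall_compl_eq_zero]
    · exact b.integral_normed
    · intro x hx
      exact image_eq_zero_of_notMem_tsupport (fun h => hx (hηs h))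
  refine ⟨∫ ξ, u ξ * η ξ ∂vol01, ?_⟩
  set c := ∫ ξ, u ξ * η ξ ∂vol01 with hcdef
  have key : ∀ᵐ x ∂(volume : Measure ℝ), x ∈ Ioo (0 : ℝ) 1 → u x - c = 0 := by
    refine isOpen_Ioo.ae_eq_zero_of_integral_contDiff_smul_eq_zero ?_ ?_
    · have : IntegrableOn (fun x => u x - c) (Ioo 0 1) volume := hu.sub (integrable_const c)
      exact this.locallyIntegrableOn
    · intro g hg hgc hgs
      -- the primitive of `g - (∫ g) η` is a test function
      set m := ∫ ξ, g ξ ∂vol01 with hm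
      set q : ℝ → ℝ := fun x => g x - m * η x with hq
      have hqd : ContDiff ℝ ∞ q := hg.sub (contDiff_const.mul hηd)
      have hqz : ∀ x, x ∉ tsupport g ∪ tsupport η → q x = 0 := by
        intro x hx
        simp only [mem_union, not_or] at hx
        simp [hq, image_eq_zero_of_notMem_tsupport hx.1, image_eq_zero_of_notMem_tsupport hx.2]
      have hKc : IsCompact (tsupport g ∪ tsupport η) := hgc.isCompact.union hηc.isCompact
      have hKs : tsupport g ∪ tsupport η ⊆ Ioo (0 : ℝ) 1 := union_subset hgs hηs
      set K := tsupport g ∪ tsupport η with hK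
      obtain ⟨α, hα0, hα1⟩ : ∃ α : ℝ, 0 < α ∧ ∀ x ∈ K, α ≤ x := by
        rcases K.eq_empty_or_nonempty with hE | hE
        · exact ⟨1, one_pos, by simp [hE]⟩
        · obtain ⟨x, hx, hmin⟩ := hKc.exists_isLeast hE
          exact ⟨x, (hKs hx).1, hmin⟩
      obtain ⟨β, hβ0, hβ1⟩ : ∃ β : ℝ, β < 1 ∧ ∀ x ∈ K, x ≤ β := by
        rcases K.eq_empty_or_nonempty with hE | hE
        · exact ⟨0, one_pos, by simp [hE]⟩
        · obtain ⟨x, hx, hmax⟩ := hKc.exists_isGreatest hE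
          exact ⟨x, (hKs hx).2, hmax⟩
      have hqi : ∫ x in (0 : ℝ)..1, q x = 0 := by
        rw [← integral_vol01, hq, integral_sub, integral_const_mul, hηi, mul_one, sub_self]
        · exact (hg.continuous.integrable_of_hasCompactSupport hgc).integrableOn
        · exact ((hηd.continuous.integrable_of_hasCompactSupport hηc).const_mul m).integrableOn
      set ψ : ℝ → ℝ := fun x => ∫ t in (0 : ℝ)..x, q t with hψ
      have hψ' : ∀ x, HasDerivAt ψ (q x) x := fun x =>
        intervalIntegral.integral_hasDerivAt_right (hqd.continuous.intervalIntegrable _ _)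
          hqd.continuous.aestronglyMeasurable.stronglyMeasurableAtFilter hqd.continuous.continuousAt
      have hderiv : deriv ψ = q := funext fun x => (hψ' x).deriv
      have hψd : ContDiff ℝ ∞ ψ := by
        rw [contDiff_infty_iff_deriv]
        exact ⟨fun x => (hψ' x).differentiableAt, hderiv ▸ hqd⟩
      have hψz : ∀ x, x ∉ Icc α β → ψ x = 0 := by
        intro x hx
        rw [mem_Icc, not_and_or, not_le, not_le] at hx
        rcases hx with hx | hx
        · apply intervalIntegral.integral_zero_ae
          refine Eventually.of_forall fun t ht => hqz t fun htK => ?_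
          have := hα1 t htK
          have := ht.2
          have h2 : max 0 x < α := max_lt hα0 hx
          linarith
        · have hsplit : ψ x = (∫ t in (0 : ℝ)..1, q t) - ∫ t in x..1, q t := by
            rw [hψ, eq_sub_iff_add_eq]
            exact intervalIntegral.integral_add_adjacent_intervals
              (hqd.continuous.intervalIntegrable _ _) (hqd.continuous.intervalIntegrable _ _)
          rw [hsplit, hqi, zero_sub, neg_eq_zero]
          apply intervalIntegral.integral_zero_ae
          refine Eventually.of_forall fun t ht => hqz t fun htK => ?_
          have := hβ1 t htK
          have := ht.1
          have h2 : β < min x 1 := lt_min hx hβ0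
          linarith
      have hψsub : tsupport ψ ⊆ Icc α β :=
        closure_minimal (fun x hx => by by_contra hn; exact hx (hψz x hn)) isClosed_Icc
      have hψc : HasCompactSupport ψ := isCompact_Icc.of_isClosed_subset (isClosed_tsupport _) hψsub
      have := h ψ hψd hψc (hψsub.trans fun x hx => ⟨hα0.trans_le hx.1, hx.2.trans_lt hβ0⟩)
      rw [hderiv] at this
      simp only [zero_mul, integral_zero, neg_zero] at this
      have i1 : Integrable (fun ξ => u ξ * g ξ) vol01 := integrable_mul_test hu hg.continuous hgc
      have i2 : Integrable (fun ξ => u ξ * η ξ) vol01 := integrable_mul_test hu hηd.continuous hηc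
      have e1 : ∫ ξ, u ξ * g ξ ∂vol01 = m * c := by
        have : ∫ ξ, u ξ * g ξ - m * (u ξ * η ξ) ∂vol01 = 0 := by
          rw [← this]; congr 1; ext ξ; simp only [hq]; ring
        rw [integral_sub i1 (i2.const_mul m), integral_const_mul] at this
        linarith
      have e2 : ∫ x, g x • (u x - c) = ∫ x, g x • (u x - c) ∂vol01 := by
        rw [setIntegral_eq_integral_of_forall_compl_eq_zero]
        intro x hx
        simp [image_eq_zero_of_notMem_tsupport (fun h => hx (hgs h))]
      rw [e2]
      have e3 : ∫ x, g x • (u x - c) ∂vol01 = ∫ x, u x * g x - c * g x ∂vol01 := by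
        congr 1; ext x; simp only [smul_eq_mul]; ring
      rw [e3, integral_sub i1, integral_const_mul, e1, ← hm]
      · ring
      · exact ((hg.continuous.integrable_of_hasCompactSupport hgc).const_mul c).integrableOn
  filter_upwards [(ae_restrict_iff' measurableSet_Ioo).2 key] with x hx
  linarith

theorem IsWeakDeriv.congr {u u' v v' : ℝ → ℝ} (h : IsWeakDeriv u v) (hu : u =ᵐ[vol01] u')
    (hv : v =ᵐ[vol01] v') : IsWeakDeriv u' v' := by
  intro φ h1 h2 h3
  have e1 : ∫ ξ, u ξ * deriv φ ξ ∂vol01 = ∫ ξ, u' ξ * deriv φ ξ ∂vol01 :=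
    integral_congr_ae (hu.mul (EventuallyEq.refl _ (deriv φ)))
  have e2 : ∫ ξ, v ξ * φ ξ ∂vol01 = ∫ ξ, v' ξ * φ ξ ∂vol01 :=
    integral_congr_ae (hv.mul (EventuallyEq.refl _ φ))
  rw [← e1, ← e2]
  exact h φ h1 h2 h3

theorem IsWeakDeriv.add {u u' v v' : ℝ → ℝ} (h : IsWeakDeriv u v) (h' : IsWeakDeriv u' v')
    (hu : Integrable u vol01) (hu' : Integrable u' vol01) (hv : Integrable v vol01)
    (hv' : Integrable v' vol01) : IsWeakDeriv (u + u') (v + v') := by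
  intro φ h1 h2 h3
  have hd : Continuous (deriv φ) := h1.continuous_deriv (by simp)
  simp only [Pi.add_apply, add_mul]
  rw [integral_add (integrable_mul_test hu hd h2.deriv) (integrable_mul_test hu' hd h2.deriv),
    integral_add (integrable_mul_test hv h1.continuous h2)
      (integrable_mul_test hv' h1.continuous h2), h φ h1 h2 h3, h' φ h1 h2 h3]
  ring

theorem IsWeakDeriv.smul {u v : ℝ → ℝ} (c : ℝ) (h : IsWeakDeriv u v) :
    IsWeakDeriv (c • u) (c • v) := by
  intro φ h1 h2 h3
  simp only [Pi.smul_apply, smul_eq_mul, mul_assoc]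
  rw [integral_const_mul, integral_const_mul, h φ h1 h2 h3]
  ring

theorem isWeakDeriv_const (c : ℝ) : IsWeakDeriv (fun _ => c) (fun _ => 0) := by
  intro φ h1 h2 h3
  have := isWeakDeriv_primitive (v := φ)
    ((h1.continuous.integrable_of_hasCompactSupport h2).integrableOn)
  have h0 : φ 0 = 0 := image_eq_zero_of_notMem_tsupport (fun h => by simpa using (h3 h).1)
  have h1' : φ 1 = 0 := image_eq_zero_of_notMem_tsupport (fun h => by simpa using (h3 h).2)
  rw [integral_const_mul, integral_vol01 (deriv φ), intervalIntegral.integral_deriv_eq_sub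
    (fun x _ => (h1.differentiable (by simp)).differentiableAt)
    ((h1.continuous_deriv (by simp)).intervalIntegrable _ _), h0, h1']
  simp

theorem integrable_primitive {v : ℝ → ℝ} (hv : Integrable v vol01) :
    Integrable (fun x => ∫ t in (0 : ℝ)..x, v t) vol01 := by
  have := intervalIntegral.continuousOn_primitive_interval (a := 0) (b := 1) (f := v)
    (μ := volume) ?_
  · rw [uIcc_of_le zero_le_one] at this
    exact (this.integrableOn_Icc).mono_set Ioo_subset_Icc_self
  · rw [uIcc_of_le zero_le_one, integrableOn_Icc_iff_integrableOn_Ioo]; exact hv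

/-- A function with an integrable weak derivative is a.e. a constant plus a primitive. -/
theorem IsWeakDeriv.exists_eq_primitive {u v : ℝ → ℝ} (h : IsWeakDeriv u v)
    (hu : Integrable u vol01) (hv : Integrable v vol01) :
    ∃ c : ℝ, u =ᵐ[vol01] fun x => c + ∫ t in (0 : ℝ)..x, v t := by
  have h1 := h.add ((isWeakDeriv_primitive hv).smul (-1)) hu ((integrable_primitive hv).smul (-1))
    hv (hv.smul (-1))
  obtain ⟨c, hc⟩ := ae_eq_const_of_weakDeriv_zero (hu.add ((integrable_primitive hv).smul (-1)))
    (h1.congr (EventuallyEq.refl _ _) (Eventually.of_forall fun x => by simp))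
  refine ⟨c, ?_⟩
  filter_upwards [hc] with x hx
  simp only [Pi.add_apply, Pi.smul_apply, smul_eq_mul] at hx
  linarith

/-- The mean-zero functions of `H¹(0, 1)`, as pairs `(x, x')` of a function and its
weak derivative. -/
def meanZeroH1 : Submodule ℝ (L2 × L2) where
  carrier := {p | IsWeakDeriv p.1 p.2 ∧ ∫ ξ, p.1 ξ ∂vol01 = 0}
  zero_mem' := by
    refine ⟨(isWeakDeriv_const 0).congr ?_ ?_, ?_⟩
    · exact (Lp.coeFn_zero ℝ 2 vol01).symm
    · exact (Lp.coeFn_zero ℝ 2 vol01).symm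
    · simp
  add_mem' := by
    rintro p q ⟨hp, hp'⟩ ⟨hq, hq'⟩
    refine ⟨(hp.add hq (integrable_L2 _) (integrable_L2 _) (integrable_L2 _)
      (integrable_L2 _)).congr (Lp.coeFn_add _ _).symm (Lp.coeFn_add _ _).symm, ?_⟩
    rw [Prod.fst_add, integral_congr_ae (Lp.coeFn_add _ _)]
    simp only [Pi.add_apply]
    rw [integral_add (integrable_L2 _) (integrable_L2 _), hp', hq', add_zero]
  smul_mem' := by
    rintro c p ⟨hp, hp'⟩
    refine ⟨(hp.smul c).congr (Lp.coeFn_smul _ _).symm (Lp.coeFn_smul _ _).symm, ?_⟩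
    rw [Prod.smul_fst, integral_congr_ae (Lp.coeFn_smul _ _)]
    simp only [Pi.smul_apply, smul_eq_mul]
    rw [integral_const_mul, hp', mul_zero]

/-- The space `V` of mean-zero functions in `H¹(0, 1)`; it carries the inner product
`⟨x, y⟩_V = ∫ x' y'`. -/
def V : Type := meanZeroH1

instance : AddCommGroup V := inferInstanceAs (AddCommGroup meanZeroH1)

instance : Module ℝ V := inferInstanceAs (Module ℝ meanZeroH1)

/-- The element of `L²(0, 1)` underlying an element of `V`. -/
def V.fn : V →ₗ[ℝ] L2 := (LinearMap.fst ℝ L2 L2).comp meanZeroH1.subtype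

/-- The weak derivative of an element of `V`. -/
def V.dn : V →ₗ[ℝ] L2 := (LinearMap.snd ℝ L2 L2).comp meanZeroH1.subtype

theorem V.isWeakDeriv (x : V) : IsWeakDeriv (V.fn x) (V.dn x) := x.2.1

theorem V.integral_eq_zero (x : V) : ∫ ξ, V.fn x ξ ∂vol01 = 0 := x.2.2

theorem V.ext {x y : V} (h : V.fn x = V.fn y) (h' : V.dn x = V.dn y) : x = y :=
  Subtype.ext (Prod.ext h h')

theorem norm_primitive_le (v : L2) {x : ℝ} (hx : x ∈ Ioo (0 : ℝ) 1) :
    ‖∫ t in (0 : ℝ)..x, v t‖ ≤ ‖v‖ := by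
  have h1 : ‖∫ t in (0 : ℝ)..x, v t‖ ≤ ∫ t, ‖v t‖ ∂vol01 := by
    refine (intervalIntegral.norm_integral_le_integral_norm hx.1.le).trans ?_
    rw [intervalIntegral.integral_of_le hx.1.le]
    exact setIntegral_mono_set (integrable_L2 v).norm
      (Eventually.of_forall fun t => norm_nonneg _)
      (LE.le.eventuallyLE (show Ioc 0 x ≤ Ioo 0 1 from fun t ht => ⟨ht.1, ht.2.trans_lt hx.2⟩))
  refine h1.trans ?_
  rw [integral_norm_eq_lintegral_enorm (integrable_L2 v).aestronglyMeasurable,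
    ← eLpNorm_one_eq_lintegral_enorm, Lp.norm_def]
  refine ENNReal.toReal_mono (Lp.eLpNorm_ne_top v) ?_
  exact eLpNorm_le_eLpNorm_of_exponent_le (by norm_num) (Lp.aestronglyMeasurable v)

/-- The Poincaré inequality on `V`. -/
theorem V.norm_fn_le (x : V) : ‖V.fn x‖ ≤ 2 * ‖V.dn x‖ := by
  obtain ⟨c, hc⟩ := (V.isWeakDeriv x).exists_eq_primitive (integrable_L2 _) (integrable_L2 _)
  have hp := integrable_primitive (integrable_L2 (V.dn x))
  have hw : ∀ᵐ ξ ∂vol01, ‖∫ t in (0 : ℝ)..ξ, V.dn x t‖ ≤ ‖V.dn x‖ :=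
    (ae_restrict_iff' measurableSet_Ioo).2
      (Eventually.of_forall fun ξ hξ => norm_primitive_le (V.dn x) hξ)
  have hcn : ‖c‖ ≤ ‖V.dn x‖ := by
    have h0 := V.integral_eq_zero x
    rw [integral_congr_ae hc, integral_add (integrable_const c) hp] at h0
    simp only [integral_const, probReal_univ, one_smul] at h0
    rw [eq_neg_of_add_eq_zero_left h0, norm_neg]
    simpa using norm_integral_le_of_norm_le_const hw
  refine Lp.norm_le_of_ae_bound (by positivity) ?_ |>.trans (b := (vol01.real univ) ^
    ((2 : ℝ≥0∞).toReal)⁻¹ * (2 * ‖V.dn x‖)) (by simp)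
  filter_upwards [hc, hw] with ξ h1 h2
  rw [h1]
  exact (norm_add_le _ _).trans (by linarith)

/-- The inner product `⟨x, y⟩_V = ∫ x' y'` on `V`. -/
@[reducible] def V.core : InnerProductSpace.Core ℝ V where
  inner x y := inner ℝ (V.dn x) (V.dn y)
  conj_inner_symm x y := by simp [real_inner_comm]
  re_inner_nonneg x := by simp
  add_left x y z := by simp [inner_add_left]
  smul_left x y r := by simp [inner_smul_left]
  definite x h := by
    have hd : V.dn x = 0 := inner_self_eq_zero.1 h
    have hf : V.fn x = 0 := by
      have := V.norm_fn_le x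
      rw [hd, norm_zero, mul_zero] at this
      exact norm_le_zero_iff.1 this
    exact V.ext (hf.trans (map_zero _).symm) (hd.trans (map_zero _).symm)

instance : NormedAddCommGroup V := V.core.toNormedAddCommGroup

instance : InnerProductSpace ℝ V := InnerProductSpace.ofCore V.core.toCore

theorem V.inner_def (x y : V) : inner ℝ x y = ∫ ξ, V.dn x ξ * V.dn y ξ ∂vol01 := by
  change inner ℝ (V.dn x) (V.dn y) = _
  rw [L2.inner_def]
  simp [mul_comm]

theorem V.norm_dn (x : V) : ‖V.dn x‖ = ‖x‖ := by
  rw [@norm_eq_sqrt_real_inner _ _ _ (V.dn x), @norm_eq_sqrt_real_inner _ _ _ x]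
  rfl

theorem V.dn_surjective : Function.Surjective V.dn := by
  intro v
  have hv := integrable_L2 v
  set w : ℝ → ℝ := fun x => ∫ t in (0 : ℝ)..x, v t with hw
  have hwi : Integrable w vol01 := integrable_primitive hv
  set c : ℝ := - ∫ ξ, w ξ ∂vol01 with hc
  have hwd : IsWeakDeriv (w + fun _ => c) ((v : ℝ → ℝ) + fun _ => 0) :=
    (isWeakDeriv_primitive hv).add (isWeakDeriv_const c) hwi (integrable_const c) hv
      (integrable_const 0)
  have hm : MemLp (w + fun _ => c) 2 vol01 := by
    refine MemLp.of_bound (hwi.add (integrable_const c)).aestronglyMeasurable (‖v‖ + ‖c‖) ?_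
    refine (ae_restrict_iff' measurableSet_Ioo).2 (Eventually.of_forall fun ξ hξ => ?_)
    exact (norm_add_le _ _).trans (add_le_add_left (norm_primitive_le v hξ) _)
  refine ⟨⟨(hm.toLp, v), hwd.congr hm.coeFn_toLp.symm
    (Eventually.of_forall fun ξ => add_zero (v ξ)), ?_⟩, rfl⟩
  rw [integral_congr_ae hm.coeFn_toLp]
  simp only [Pi.add_apply]
  rw [integral_add hwi (integrable_const c)]
  simp [hc]

instance : CompleteSpace V := by
  let e : V ≃ₗᵢ[ℝ] L2 := LinearIsometryEquiv.ofSurjective ⟨V.dn, V.norm_dn⟩ V.dn_surjective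
  exact (completeSpace_congr (e := e.toEquiv) e.isometry.isUniformEmbedding).2 inferInstance

/-! ### The dual space `H` -/

/-- `H` is the dual space of `V`, with the dual norm. -/
def H : Type := StrongDual ℝ V

instance : NormedAddCommGroup H := inferInstanceAs (NormedAddCommGroup (StrongDual ℝ V))

instance : NormedSpace ℝ H := inferInstanceAs (NormedSpace ℝ (StrongDual ℝ V))

instance : CompleteSpace H := inferInstanceAs (CompleteSpace (StrongDual ℝ V))

instance : FunLike H V ℝ := inferInstanceAs (FunLike (StrongDual ℝ V) V ℝ)

instance : MeasurableSpace H := borel H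

instance : BorelSpace H := ⟨rfl⟩

/-- The map `B : V → H`, `Bx(y) = ∫ x' y' = ⟨x, y⟩_V`, as an isometric isomorphism. -/
def B : V ≃ₗᵢ[ℝ] H where
  toFun x := InnerProductSpace.toDual ℝ V x
  invFun x := (InnerProductSpace.toDual ℝ V).symm x
  left_inv x := (InnerProductSpace.toDual ℝ V).symm_apply_apply x
  right_inv x := (InnerProductSpace.toDual ℝ V).apply_symm_apply x
  map_add' x y := map_add (InnerProductSpace.toDual ℝ V) x y
  map_smul' c x := map_smulₛₗ (InnerProductSpace.toDual ℝ V) c x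
  norm_map' x := (InnerProductSpace.toDual ℝ V).norm_map x

theorem B_apply (x y : V) : B x y = ∫ ξ, V.dn x ξ * V.dn y ξ ∂vol01 := V.inner_def x y

/-- The inner product of `H` that induces the dual norm. -/
instance : InnerProductSpace ℝ H where
  toNormedSpace := inferInstance
  inner x y := inner ℝ (B.symm x) (B.symm y)
  norm_sq_eq_re_inner x := by
    rw [← B.symm.norm_map x]; exact norm_sq_eq_re_inner (𝕜 := ℝ) (B.symm x)
  conj_inner_symm x y := by simp [real_inner_comm]
  add_left x y z := by simp [inner_add_left]
  smul_left x y r := by simp [inner_smul_left]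

theorem H.inner_def (x y : H) : inner ℝ x y = x (B.symm y) := by
  obtain ⟨u, rfl⟩ := B.surjective x
  change inner ℝ (B.symm (B u)) (B.symm y) = _
  rw [B.symm_apply_apply]
  rfl

/-- The inclusion of `V` into `L²(0, 1)`. -/
def V.toL2 : V →L[ℝ] L2 :=
  V.fn.mkContinuous 2 fun x => by rw [← V.norm_dn]; exact V.norm_fn_le x

/-- The map `L²(0, 1) → H` sending `g` to the functional `y ↦ ∫ g y`. On mean-zero functions it is
the identification of functions with elements of `H`. -/
def ofL2 : L2 →L[ℝ] H :=
  (((ContinuousLinearMap.compL ℝ V L2 ℝ).flip V.toL2).comp (innerSL ℝ) :)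

theorem ofL2_apply (g : L2) (y : V) : ofL2 g y = ∫ ξ, g ξ * V.fn y ξ ∂vol01 := by
  change inner ℝ g (V.fn y) = _
  rw [L2.inner_def]
  simp [mul_comm]

/-- The inclusion of `V` into `H`. -/
def ι : V →L[ℝ] H := ofL2.comp V.toL2

/-- The inverse of `B`, regarded as an unbounded operator in `H` with domain `V`. -/
def Binv : H →L[ℝ] H := ι.comp (B.symm.toContinuousLinearEquiv : H →L[ℝ] V)

/-- The covariance operator `Q = - A⁻¹ / 2`, where `A = - B²`; that is, `Q = B⁻² / 2`. -/
def Q : H →L[ℝ] H := (1 / 2 : ℝ) • Binv.comp Binv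

/-- `Q = - A⁻¹ / 2`: each `Qx` lies in `D(A) = {u ∈ V : Bu ∈ V}`, and
`A (Qx) = - B (B (Qx)) = - x / 2`. -/
theorem Q_spec (x : H) : ∃ u v : V, Q x = ι u ∧ B u = ι v ∧ -(B v) = -(1 / 2 : ℝ) • x := by
  refine ⟨(1 / 2 : ℝ) • B.symm (ι (B.symm x)), (1 / 2 : ℝ) • B.symm x, ?_, ?_, ?_⟩
  · rw [map_smul]; rfl
  · rw [map_smul, map_smul, B.apply_symm_apply]
  · rw [map_smul, B.apply_symm_apply]; simp

/-- The positive square root `Q^{1/2} = B⁻¹ / √2` of `Q`. -/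
def Qhalf : H →L[ℝ] H := (√2)⁻¹ • Binv

theorem Qhalf_comp_Qhalf : Qhalf.comp Qhalf = Q := by
  ext1 x
  have : (√2)⁻¹ * (√2)⁻¹ = (1 / 2 : ℝ) := by
    rw [← mul_inv, Real.mul_self_sqrt (by norm_num)]; norm_num
  simp only [Qhalf, Q, ContinuousLinearMap.comp_apply, _root_.smul_apply, map_smul,
    smul_smul, this]

theorem inner_Binv (x y : H) :
    inner ℝ (Binv x) y = inner ℝ (V.toL2 (B.symm x)) (V.toL2 (B.symm y)) := by
  rw [H.inner_def]; rfl

theorem Qhalf_isPositive : Qhalf.IsPositive := by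
  have h : ∀ x y : H, inner ℝ (Qhalf x) y = (√2)⁻¹ * inner ℝ (V.toL2 (B.symm x))
      (V.toL2 (B.symm y)) := by
    intro x y
    rw [← inner_Binv, Qhalf, _root_.smul_apply, real_inner_smul_left]
  refine ⟨fun x y => ?_, fun x => ?_⟩
  · change inner ℝ (Qhalf x) y = inner ℝ x (Qhalf y)
    rw [h, real_inner_comm (Qhalf y) x, h, real_inner_comm]
  · rw [ContinuousLinearMap.reApplyInnerSelf_apply, h]
    exact mul_nonneg (by positivity) real_inner_self_nonneg

/-- The function `f_k(ξ) = k π e_k(ξ) = √2 k π cos(k π ξ)`. -/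
def fFun (k : ℕ) (ξ : ℝ) : ℝ := k * Real.pi * (√2 * Real.cos (k * Real.pi * ξ))

theorem memLp_fFun (k : ℕ) : MemLp (fFun k) 2 vol01 := by
  have hc : Continuous (fFun k) := by unfold fFun; fun_prop
  refine MemLp.of_bound hc.aestronglyMeasurable (|k * Real.pi| * |√2|)
    (Eventually.of_forall fun ξ => ?_)
  rw [fFun, Real.norm_eq_abs, abs_mul, abs_mul (√2)]
  exact mul_le_mul_of_nonneg_left
    (mul_le_of_le_one_right (abs_nonneg _) (Real.abs_cos_le_one _)) (abs_nonneg _)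

/-- The orthonormal basis `f_1, f_2, …` of `H`. (The value at `k = 0` is irrelevant.) -/
def f (k : ℕ) : H := ofL2 (memLp_fFun k).toLp

/-- The eigenvalues `λ_k = 1 / (2 π⁴ k⁴)` of `Q`: `Q f_k = λ_k f_k` for `k ≥ 1`. -/
def eig (k : ℕ) : ℝ := 1 / (2 * Real.pi ^ 4 * (k : ℝ) ^ 4)

/-- The orthogonal projection `P_n` on the span of `f_1, …, f_n`. -/
def P (n : ℕ) (x : H) : H := ∑ k ∈ Finset.Icc 1 n, inner ℝ x (f k) • f k

/-- `g ∈ L̃^p(0, 1)` (the mean-zero functions in `L^p(0, 1)`) is identified with `x ∈ H`, that is,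
`x(y) = ∫ g y` for all `y ∈ V`. -/
def Represents (p : ℝ≥0∞) (g : ℝ → ℝ) (x : H) : Prop :=
  MemLp g p vol01 ∧ ∫ ξ, g ξ ∂vol01 = 0 ∧ ∀ y : V, x y = ∫ ξ, g ξ * V.fn y ξ ∂vol01

/-- The subset `L̃^p(0, 1)` of `H`. -/
def LTilde (p : ℝ≥0∞) : Set H := {x | ∃ g, Represents p g x}

open Classical in
/-- The function `ξ ↦ x(ξ)` identified with `x`, for `x ∈ L̃¹(0, 1)` (unique up to a.e. equality);
zero for the other `x ∈ H`. -/
def toFun (x : H) : ℝ → ℝ := if h : ∃ g, Represents 1 g x then h.choose else 0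

/-! ### Gaussian measures and Sobolev spaces -/

section Sobolev

variable {E : Type*} [NormedAddCommGroup E] [InnerProductSpace ℝ E] [MeasurableSpace E]

/-- `μ` is the Gaussian measure `N_{0, R}` with mean `0` and covariance operator `R`. -/
structure IsCenteredGaussian (R : E →L[ℝ] E) (μ : Measure E) : Prop where
  isGaussian : IsGaussian μ
  mean : ∀ y : E, ∫ x, inner ℝ x y ∂μ = 0
  cov : ∀ y z : E, ∫ x, inner ℝ x y * inner ℝ x z ∂μ = inner ℝ (R y) z

/-- The class `FC¹_b` of cylindrical functions `x ↦ ϕ(x_1, …, x_n)`, where `x_k = ⟨x, b_k⟩` and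
`ϕ` is a `C¹` function on `ℝⁿ`, bounded with bounded derivative. -/
def IsCylindrical (b : ℕ → E) (φ : E → ℝ) : Prop :=
  ∃ (n : ℕ) (ϕ : (Fin n → ℝ) → ℝ), ContDiff ℝ 1 ϕ ∧ (∃ C : ℝ, ∀ y, |ϕ y| ≤ C) ∧
    (∃ C : ℝ, ∀ y, ‖fderiv ℝ ϕ y‖ ≤ C) ∧ φ = fun x => ϕ fun i => inner ℝ x (b (i + 1))

/-- `(u, G)` belongs to the closure in `L^p(E, μ) × L^p(E, μ; E)` of the graph of the operator
`φ ↦ S Dφ` defined on `FC¹_b`. With `S = R^{1/2}`, where `R` is the covariance operator of `μ`,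
this says that `u` belongs to `W^{1,p}_{1/2}(E, μ)` and that `G = R^{1/2} Du`. -/
structure HasSobolevGrad [CompleteSpace E] (μ : Measure E) (b : ℕ → E) (S : E →L[ℝ] E) (p : ℝ≥0∞)
    (u : E → ℝ) (G : E → E) : Prop where
  memLp : MemLp u p μ
  memLp_grad : MemLp G p μ
  approx : ∃ φ : ℕ → E → ℝ, (∀ m, IsCylindrical b (φ m)) ∧
    Tendsto (fun m => eLpNorm (fun x => φ m x - u x) p μ) atTop (𝓝 0) ∧
    Tendsto (fun m => eLpNorm (fun x => S (gradient (φ m) x) - G x) p μ) atTop (𝓝 0)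

end Sobolev

/-- `u` belongs to the space `W^{1,p}_{1/2}(H, μ)`. -/
def MemW (μ : Measure H) (p : ℝ≥0∞) (u : H → ℝ) : Prop :=
  ∃ G : H → H, HasSobolevGrad μ f Qhalf p u G

/-- `D : H → ℝ` is the `k`-th partial derivative `D_k u = λ_k^{-1/2} ⟨Q^{1/2} Du, f_k⟩` of
`u ∈ W^{1,p}_{1/2}(H, μ)` (for every version of `Q^{1/2} Du`). -/
def IsPartialDeriv (μ : Measure H) (p : ℝ≥0∞) (u : H → ℝ) (k : ℕ) (D : H → ℝ) : Prop :=
  MemW μ p u ∧ ∀ G : H → H, HasSobolevGrad μ f Qhalf p u G →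
    ∀ᵐ x ∂μ, D x = (√(eig k))⁻¹ * inner ℝ (G x) (f k)

/-! ### The potential -/

/-- The assumptions on `Φ`: it is `C¹`, convex and bounded from below, `Φ'` has polynomial growth
of order `p₂ ≥ 1`, and `Φ(r) / |r| → +∞` as `r → ±∞`. -/
structure IsPotential (Φ : ℝ → ℝ) (C p₂ : ℝ) : Prop where
  contDiff : ContDiff ℝ 1 Φ
  convex : ConvexOn ℝ univ Φ
  bddBelow : BddBelow (range Φ)
  C_pos : 0 < C
  one_le : 1 ≤ p₂
  growth : ∀ t : ℝ, |deriv Φ t| ≤ C * (1 + |t| ^ p₂)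
  tendsto_atTop : Tendsto (fun r => Φ r / |r|) atTop atTop
  tendsto_atBot : Tendsto (fun r => Φ r / |r|) atBot atTop

open Classical in
/-- `U(x) = ∫ Φ(x(ξ)) dξ` if `x ∈ L̃^{p₁}(0, 1)`, where `p₁ = p₂ + 1`, and `U(x) = +∞` otherwise. -/
def U (Φ : ℝ → ℝ) (p₂ : ℝ) (x : H) : EReal :=
  if x ∈ LTilde (ENNReal.ofReal (p₂ + 1)) then ((∫ ξ, Φ (toFun x ξ) ∂vol01 : ℝ) : EReal) else ⊤

/-- `U_n(x) = ∫ Φ(P_n x(ξ)) dξ`, where `P_n x(ξ) = ∑_{k ≤ n} ⟨x, f_k⟩ f_k(ξ)`. -/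
def Un (Φ : ℝ → ℝ) (n : ℕ) (x : H) : ℝ :=
  ∫ ξ, Φ (∑ k ∈ Finset.Icc 1 n, inner ℝ x (f k) * fFun k ξ) ∂vol01

end

end CahnHilliard

namespace CahnHilliard

/-! ### Cosine functions on the unit interval -/

/-! The point is that μ-almost every `x` is an honest function of ξ lying in every L^q(0,1). For
fixed ξ the partial sum P_n x(ξ) is a linear functional of `x`, hence Gaussian, and the block of
terms m < k ≤ n has variance ∑ λ_k f_k(ξ)² = ∑ cos²(kπξ)/(π²k²). This is dominated by a convergent
series, uniformly in ξ. For Gaussian variables every L^q norm is a constant times the standard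
deviation, so the partial sums are Cauchy in L^q(μ ⊗ dξ) for all q (`eLpNorm_partialField_sub_le`).
Their common limit `S` (`exists_isField`) has sections S(x,·) that represent `x` for almost every
`x` (`IsField.ae_represents`), because the f_k are complete in `H`. Hence U(x) = ∫ Φ(S(x,ξ)) dξ
almost everywhere.

Since Φ and Φ' grow polynomially and all moments of P_n x(ξ) are bounded, Vitali's theorem carries
convergence in measure through compositions (`tendsto_eLpNorm_comp`). This gives U_n → U in L^p.

For the gradient, Φ is composed with a bounded truncation so that x ↦ ∫ F(P_n x(ξ)) dξ becomes
cylindrical. With g identified with y ↦ ∫ g y, its Q^{1/2}-gradient is P_n applied to F'(P_n x)/√2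
(`Qhalf_gradient_cylFunctional`). This formula survives the limit and gives Q^{1/2}DU = Φ'(x)/√2
(`IsField.hasSobolevGrad`), whose coordinates are the claimed partial derivatives.

The partial derivative is asserted for every pair in the closure of the graph, so the gradient must
also be unique. Gaussian integration by parts expresses weighted integrals of its components through
`u` alone, and trigonometric weights separate integrable functions (`HasSobolevGrad.ae_unique`). -/

theorem integrable_continuous_mul {v g : ℝ → ℝ} (hv : Integrable v vol01) (hg : Continuous g) :
    Integrable (fun ξ => v ξ * g ξ) vol01 := by
  obtain ⟨C, hC⟩ := isCompact_Icc.exists_bound_of_continuousOn (s := Icc (0 : ℝ) 1) hg.continuousOn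
  refine hv.mul_bdd (c := C) hg.aestronglyMeasurable ?_
  exact (ae_restrict_iff' measurableSet_Ioo).2
    (Eventually.of_forall fun ξ hξ => hC ξ (Ioo_subset_Icc_self hξ))

theorem integrable_of_continuous {g : ℝ → ℝ} (hg : Continuous g) : Integrable g vol01 := by
  simpa using integrable_continuous_mul (integrable_const (1 : ℝ)) hg

theorem memLp_of_continuous {g : ℝ → ℝ} (hg : Continuous g) (p : ℝ≥0∞) : MemLp g p vol01 := by
  obtain ⟨C, hC⟩ := isCompact_Icc.exists_bound_of_continuousOn (s := Icc (0 : ℝ) 1) hg.continuousOn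
  refine MemLp.of_bound hg.aestronglyMeasurable C ?_
  exact (ae_restrict_iff' measurableSet_Ioo).2
    (Eventually.of_forall fun ξ hξ => hC ξ (Ioo_subset_Icc_self hξ))

/-- An integrable function on `(0, 1)` that annihilates all test functions vanishes. -/
theorem ae_eq_zero_of_test {v : ℝ → ℝ} (hv : Integrable v vol01)
    (h : ∀ φ : ℝ → ℝ, ContDiff ℝ ∞ φ → HasCompactSupport φ → tsupport φ ⊆ Ioo 0 1 →
      ∫ ξ, v ξ * φ ξ ∂vol01 = 0) : v =ᵐ[vol01] 0 := by
  have hv' : IntegrableOn v (Ioo 0 1) volume := hv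
  refine (ae_restrict_iff' measurableSet_Ioo).2
    (isOpen_Ioo.ae_eq_zero_of_integral_contDiff_smul_eq_zero hv'.locallyIntegrableOn ?_)
  intro g hg hc hs
  rw [← h g hg hc hs, setIntegral_eq_integral_of_forall_compl_eq_zero]
  · simp only [smul_eq_mul, mul_comm]
  · intro x hx
    simp [image_eq_zero_of_notMem_tsupport (fun h => hx (hs h))]

/-- The cosines `cos(kπξ)`, `k ≥ 0`, are complete in `L¹(0, 1)`. -/
theorem ae_eq_zero_of_integral_cos {v : ℝ → ℝ} (hv : Integrable v vol01)
    (h : ∀ k : ℕ, ∫ ξ, v ξ * Real.cos (k * Real.pi * ξ) ∂vol01 = 0) : v =ᵐ[vol01] 0 := by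
  have hint : ∀ g : ℝ → ℝ, Continuous g → Integrable (fun ξ => v ξ * g ξ) vol01 :=
    fun g hg => integrable_continuous_mul hv hg
  -- The product-to-sum formula lowers the power n at the price of shifting k to k ± 1, so k has to
  -- range over ℤ.
  have hpow : ∀ n : ℕ, ∀ k : ℤ, ∫ ξ, v ξ *
      (Real.cos (Real.pi * ξ) ^ n * Real.cos (k * Real.pi * ξ)) ∂vol01 = 0 := by
    intro n
    induction n with
    | zero =>
      intro k
      rcases Int.natAbs_eq k with hk | hk
      · rw [hk]; simpa using h k.natAbs
      · rw [hk]
        have := h k.natAbs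
        simpa [neg_mul, Real.cos_neg] using this
    | succ n ih =>
      intro k
      have e : ∀ ξ, v ξ * (Real.cos (Real.pi * ξ) ^ (n + 1) * Real.cos (k * Real.pi * ξ)) =
          (1 / 2) * (v ξ * (Real.cos (Real.pi * ξ) ^ n * Real.cos ((k + 1 : ℤ) * Real.pi * ξ))) +
          (1 / 2) * (v ξ * (Real.cos (Real.pi * ξ) ^ n *
            Real.cos ((k - 1 : ℤ) * Real.pi * ξ))) := by
        intro ξ
        have e1 : ((k + 1 : ℤ) : ℝ) * Real.pi * ξ = k * Real.pi * ξ + Real.pi * ξ := by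
          push_cast; ring
        have e2 : ((k - 1 : ℤ) : ℝ) * Real.pi * ξ = k * Real.pi * ξ - Real.pi * ξ := by
          push_cast; ring
        rw [e1, e2, Real.cos_add, Real.cos_sub]
        ring
      simp_rw [e]
      rw [integral_add ((hint _ (by fun_prop)).const_mul _) ((hint _ (by fun_prop)).const_mul _),
        integral_const_mul, integral_const_mul, ih, ih]
      simp
  have hpoly : ∀ p : Polynomial ℝ, ∫ ξ, v ξ * p.eval (Real.cos (Real.pi * ξ)) ∂vol01 = 0 := by
    intro p
    simp_rw [Polynomial.eval_eq_sum_range, Finset.mul_sum]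
    rw [integral_finsetSum]
    · refine Finset.sum_eq_zero fun n _ => ?_
      have := hpow n 0
      simp only [Int.cast_zero, zero_mul, Real.cos_zero, mul_one] at this
      simp_rw [mul_left_comm (v _)]
      rw [integral_const_mul, this, mul_zero]
    · intro n _
      exact hint _ (by fun_prop)
  refine ae_eq_zero_of_test hv fun φ hφ _ _ => ?_
  set N := ∫ ξ, |v ξ| ∂vol01 with hN
  have hN0 : 0 ≤ N := integral_nonneg fun _ => abs_nonneg _
  have key : ∀ ε : ℝ, 0 < ε → |∫ ξ, v ξ * φ ξ ∂vol01| ≤ ε * N := by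
    intro ε hε
    -- Weierstrass in the variable t = cos(πξ), which maps [0,1] homeomorphically onto [-1,1].
    obtain ⟨p, hp⟩ := exists_polynomial_near_of_continuousOn (-1) 1
      (fun t => φ (Real.arccos t / Real.pi)) (by
        have := hφ.continuous
        have := Real.continuous_arccos
        fun_prop) ε hε
    have e : ∫ ξ, v ξ * φ ξ ∂vol01 =
        ∫ ξ, v ξ * φ ξ - v ξ * p.eval (Real.cos (Real.pi * ξ)) ∂vol01 := by
      rw [integral_sub (hint _ hφ.continuous) (hint _ (by fun_prop)), hpoly, sub_zero]
    rw [e, hN, ← integral_const_mul, ← Real.norm_eq_abs]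
    refine norm_integral_le_of_norm_le (hv.abs.const_mul ε) ?_
    refine (ae_restrict_iff' measurableSet_Ioo).2 (Eventually.of_forall fun ξ hξ => ?_)
    have h1 := hp (Real.cos (Real.pi * ξ)) ⟨Real.neg_one_le_cos _, Real.cos_le_one _⟩
    rw [Real.arccos_cos (by have := Real.pi_pos; nlinarith [hξ.1])
      (by have := Real.pi_pos; nlinarith [hξ.2]), mul_div_cancel_left₀ _ Real.pi_ne_zero] at h1
    rw [← mul_sub, norm_mul, mul_comm, Real.norm_eq_abs, Real.norm_eq_abs, abs_sub_comm]
    exact mul_le_mul_of_nonneg_right h1.le (abs_nonneg _)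
  by_contra hne
  have hpos := abs_pos.2 hne
  -- This ε makes the bound at most half the integral; the `+ 1` covers N = 0.
  have h1 := key (|∫ ξ, v ξ * φ ξ ∂vol01| / (2 * (N + 1))) (by positivity)
  rw [div_mul_eq_mul_div, le_div_iff₀ (by positivity)] at h1
  nlinarith

theorem continuous_fFun (k : ℕ) : Continuous (fFun k) := by unfold fFun; fun_prop

theorem integral_cos_int {n : ℤ} (hn : n ≠ 0) :
    ∫ ξ, Real.cos (n * Real.pi * ξ) ∂vol01 = 0 := by
  have hne : (n : ℝ) * Real.pi ≠ 0 := mul_ne_zero (by exact_mod_cast hn) Real.pi_ne_zero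
  rw [integral_vol01, intervalIntegral.integral_comp_mul_left (fun x => Real.cos x) hne]
  simp [integral_cos, Real.sin_int_mul_pi]

theorem integral_fFun {k : ℕ} (hk : 1 ≤ k) : ∫ ξ, fFun k ξ ∂vol01 = 0 := by
  have := integral_cos_int (n := k) (by omega)
  simp only [Int.cast_natCast] at this
  simp only [fFun]
  rw [integral_const_mul, integral_const_mul, this]
  simp

/-- Product-to-sum leaves cosines of frequency j + k and j - k. With j ≥ 1 the first always
integrates to zero, and the second does unless j = k. -/
theorem integral_fFun_mul_fFun {j k : ℕ} (hj : 1 ≤ j) :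
    ∫ ξ, fFun j ξ * fFun k ξ ∂vol01 = if j = k then (k * Real.pi) ^ 2 else 0 := by
  have e : ∀ ξ, fFun j ξ * fFun k ξ = (j * Real.pi * (k * Real.pi)) *
      (Real.cos ((j + k : ℤ) * Real.pi * ξ) + Real.cos ((j - k : ℤ) * Real.pi * ξ)) := by
    intro ξ
    have e1 : ((j + k : ℤ) : ℝ) * Real.pi * ξ = j * Real.pi * ξ + k * Real.pi * ξ := by
      push_cast; ring
    have e2 : ((j - k : ℤ) : ℝ) * Real.pi * ξ = j * Real.pi * ξ - k * Real.pi * ξ := by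
      push_cast; ring
    have h2 : √2 * √2 = (2 : ℝ) := Real.mul_self_sqrt (by norm_num)
    rw [e1, e2, Real.cos_add, Real.cos_sub, fFun, fFun]
    linear_combination (j * Real.pi * (Real.cos (j * Real.pi * ξ)) *
      (k * Real.pi * (Real.cos (k * Real.pi * ξ)))) * h2
  simp_rw [e]
  rw [integral_const_mul, integral_add (integrable_of_continuous (by fun_prop))
    (integrable_of_continuous (by fun_prop)), integral_cos_int (by omega)]
  split_ifs with h
  · subst h
    simp; ring
  · rw [integral_cos_int (by omega)]; simp

/-! ### `C¹` elements of `V` -/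

theorem isWeakDeriv_of_contDiff {g : ℝ → ℝ} (hg : ContDiff ℝ 1 g) : IsWeakDeriv g (deriv g) := by
  have hc := hg.continuous_deriv le_rfl
  have h1 := (isWeakDeriv_primitive (integrable_of_continuous hc)).add (isWeakDeriv_const (g 0))
    (integrable_primitive (integrable_of_continuous hc)) (integrable_const _)
    (integrable_of_continuous hc) (integrable_const _)
  refine h1.congr (Eventually.of_forall fun x => ?_) (Eventually.of_forall fun x => ?_)
  · simp only [Pi.add_apply]
    rw [intervalIntegral.integral_deriv_eq_sub
      (fun x _ => (hg.differentiable one_ne_zero).differentiableAt) (hc.intervalIntegrable _ _)]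
    ring
  · simp

/-- A `C¹` function with zero mean, as an element of `V`. -/
noncomputable def V.ofContDiff (g : ℝ → ℝ) (hg : ContDiff ℝ 1 g) (h0 : ∫ ξ, g ξ ∂vol01 = 0) : V :=
  ⟨((memLp_of_continuous hg.continuous 2).toLp,
    (memLp_of_continuous (hg.continuous_deriv le_rfl) 2).toLp),
    (isWeakDeriv_of_contDiff hg).congr (memLp_of_continuous hg.continuous 2).coeFn_toLp.symm
      (memLp_of_continuous (hg.continuous_deriv le_rfl) 2).coeFn_toLp.symm, by
      rw [integral_congr_ae (memLp_of_continuous hg.continuous 2).coeFn_toLp, h0]⟩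

theorem V.fn_ofContDiff {g : ℝ → ℝ} (hg : ContDiff ℝ 1 g) (h0 : ∫ ξ, g ξ ∂vol01 = 0) :
    V.fn (V.ofContDiff g hg h0) =ᵐ[vol01] g :=
  (memLp_of_continuous hg.continuous 2).coeFn_toLp

theorem V.dn_ofContDiff {g : ℝ → ℝ} (hg : ContDiff ℝ 1 g) (h0 : ∫ ξ, g ξ ∂vol01 = 0) :
    V.dn (V.ofContDiff g hg h0) =ᵐ[vol01] deriv g :=
  (memLp_of_continuous (hg.continuous_deriv le_rfl) 2).coeFn_toLp

/-- Elements of `V` are pairs, so the derivative component must vanish too; testing the weak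
derivative identity shows that it does. -/
theorem V.eq_zero_of_fn_ae_eq_zero {y : V} (h : V.fn y =ᵐ[vol01] 0) : y = 0 := by
  have hd : V.dn y =ᵐ[vol01] 0 := by
    refine ae_eq_zero_of_test (integrable_L2 _) fun φ h1 h2 h3 => ?_
    have := V.isWeakDeriv y φ h1 h2 h3
    rw [integral_congr_ae (g := fun _ => 0) (by filter_upwards [h] with ξ hξ; simp [hξ])] at this
    simpa using this
  refine V.ext ?_ ?_
  · rw [map_zero]; exact (Lp.eq_zero_iff_ae_eq_zero).2 h
  · rw [map_zero]; exact (Lp.eq_zero_iff_ae_eq_zero).2 hd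

/-- Integration by parts against an element of `V`. -/
theorem V.integral_mul_deriv (y : V) {g : ℝ → ℝ} (hg : ContDiff ℝ 1 g) (h0 : g 0 = 0)
    (h1 : g 1 = 0) : ∫ ξ, V.dn y ξ * g ξ ∂vol01 = - ∫ ξ, V.fn y ξ * deriv g ξ ∂vol01 := by
  obtain ⟨c, hc⟩ := (V.isWeakDeriv y).exists_eq_primitive (integrable_L2 _) (integrable_L2 _)
  have hvi := intervalIntegrable_of_vol01 (integrable_L2 (V.dn y))
  have hw := hvi.absolutelyContinuousOnInterval_intervalIntegral (c := 0) (by simp)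
  have hga : AbsolutelyContinuousOnInterval g 0 1 := hg.contDiffOn.absolutelyContinuousOnInterval
  have hdc := hg.continuous_deriv le_rfl
  -- The additive constant `c` contributes c(g(1) - g(0)) = 0, so only the primitive of the
  -- derivative matters.
  rw [integral_congr_ae (f := fun ξ => V.fn y ξ * deriv g ξ)
    (g := fun ξ => c * deriv g ξ + (∫ t in (0 : ℝ)..ξ, V.dn y t) * deriv g ξ)
    (by filter_upwards [hc] with ξ hξ; rw [hξ, add_mul])]
  rw [integral_add ((integrable_of_continuous hdc).const_mul c)
    (integrable_continuous_mul (integrable_primitive (integrable_L2 _)) hdc), integral_const_mul,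
    integral_vol01 (deriv g), intervalIntegral.integral_deriv_eq_sub
      (fun x _ => (hg.differentiable one_ne_zero).differentiableAt) (hdc.intervalIntegrable _ _),
    h0, h1, integral_vol01, integral_vol01, hw.integral_mul_deriv_eq_deriv_mul hga, h0, h1]
  simp only [mul_zero, sub_zero, zero_sub, zero_add, neg_neg]
  apply intervalIntegral.integral_congr_ae
  filter_upwards [hvi.ae_hasDerivAt_integral] with x hx hx'
  rw [(hx (uIoc_subset_uIcc hx') 0 (by simp)).deriv]

/-! ### The orthonormal basis of `H` -/

theorem contDiff_fFun (k : ℕ) : ContDiff ℝ ∞ (fFun k) := by unfold fFun; fun_prop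

theorem hasDerivAt_fFun (k : ℕ) (ξ : ℝ) : HasDerivAt (fFun k)
    (-((k * Real.pi) ^ 2 * √2 * Real.sin (k * Real.pi * ξ))) ξ := by
  have h1 : HasDerivAt (fun ξ : ℝ => k * Real.pi * ξ) (k * Real.pi) ξ := by
    simpa using (hasDerivAt_id ξ).const_mul ((k : ℝ) * Real.pi)
  have := ((h1.cos.const_mul (√2)).const_mul ((k : ℝ) * Real.pi))
  convert! this using 1
  ring

/-- The derivative of `fFun k` is a sine vanishing at both endpoints, so integrating by parts leaves
no boundary term, and the second derivative is -(kπ)² times the function. -/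
theorem B_fFun {k : ℕ} (v : V)
    (hd : V.dn v =ᵐ[vol01] deriv (fFun k)) : B v = ((k * Real.pi) ^ 2) • f k := by
  refine ContinuousLinearMap.ext fun y => ?_
  have hder : deriv (fFun k) = fun ξ => -((k * Real.pi) ^ 2 * √2 * Real.sin (k * Real.pi * ξ)) :=
    funext fun ξ => (hasDerivAt_fFun k ξ).deriv
  have hdd : deriv (deriv (fFun k)) = fun ξ => -((k * Real.pi) ^ 2 * fFun k ξ) := by
    funext ξ
    rw [hder]
    have h1 : HasDerivAt (fun ξ : ℝ => k * Real.pi * ξ) (k * Real.pi) ξ := by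
      simpa using (hasDerivAt_id ξ).const_mul ((k : ℝ) * Real.pi)
    rw [(h1.sin.const_mul (((k : ℝ) * Real.pi) ^ 2 * √2)).fun_neg.deriv, fFun]
    ring
  have e1 : B v y = ∫ ξ, V.dn y ξ * deriv (fFun k) ξ ∂vol01 := by
    rw [B_apply]
    exact integral_congr_ae (by filter_upwards [hd] with ξ h; rw [h, mul_comm])
  have e2 : f k y = ∫ ξ, V.fn y ξ * fFun k ξ ∂vol01 := by
    rw [f, ofL2_apply]
    exact integral_congr_ae (by
      filter_upwards [(memLp_fFun k).coeFn_toLp] with ξ h; rw [h, mul_comm])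
  have e3 : (((k * Real.pi) ^ 2) • f k) y = (k * Real.pi) ^ 2 * f k y := rfl
  change B v y = (((k * Real.pi) ^ 2) • f k) y
  rw [e1, e3, e2, V.integral_mul_deriv y _ (by rw [hder]; simp) (by rw [hder]; simp [Real.sin_nat_mul_pi]), hdd,
    ← integral_const_mul, ← integral_neg]
  · congr 1; ext ξ; ring
  · rw [hder]; fun_prop

/-- The element `f_k / (kπ)²` of `V`, which is `B⁻¹ f_k`. -/
theorem fn_symm_f {k : ℕ} (hk : 1 ≤ k) :
    V.fn (B.symm (f k)) =ᵐ[vol01] fun ξ => ((k * Real.pi) ^ 2)⁻¹ * fFun k ξ := by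
  have hc : ContDiff ℝ 1 (fFun k) := (contDiff_fFun k).of_le (by simp)
  have hB := B_fFun (V.ofContDiff _ hc (integral_fFun hk))
    (V.dn_ofContDiff _ _)
  have hne : ((k : ℝ) * Real.pi) ^ 2 ≠ 0 :=
    pow_ne_zero _ (mul_ne_zero (by exact_mod_cast (by omega : k ≠ 0)) Real.pi_ne_zero)
  have : B.symm (f k) = (((k : ℝ) * Real.pi) ^ 2)⁻¹ • V.ofContDiff _ hc (integral_fFun hk) := by
    apply B.injective
    rw [B.apply_symm_apply, map_smul, hB, smul_smul, inv_mul_cancel₀ hne, one_smul]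
  rw [this, map_smul]
  filter_upwards [Lp.coeFn_smul (((k : ℝ) * Real.pi) ^ 2)⁻¹ (V.fn (V.ofContDiff _ hc
    (integral_fFun hk))), V.fn_ofContDiff hc (integral_fFun hk)] with ξ h1 h2
  rw [h1, Pi.smul_apply, h2, smul_eq_mul]

/-- ⟨x, f_k⟩ is x evaluated at B⁻¹f_k = f_k/(kπ)². This turns inner products in `H` into integrals
over (0,1). -/
theorem inner_ofL2_f (h : L2) {k : ℕ} (hk : 1 ≤ k) :
    inner ℝ (ofL2 h) (f k) = ((k * Real.pi) ^ 2)⁻¹ * ∫ ξ, h ξ * fFun k ξ ∂vol01 := by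
  rw [H.inner_def, ofL2_apply, ← integral_const_mul]
  refine integral_congr_ae ?_
  filter_upwards [fn_symm_f hk] with ξ h
  rw [h]; ring

theorem natCast_mul_pi_sq_ne_zero {k : ℕ} (hk : 1 ≤ k) : ((k : ℝ) * Real.pi) ^ 2 ≠ 0 :=
  pow_ne_zero _ (mul_ne_zero (by exact_mod_cast (by omega : k ≠ 0)) Real.pi_ne_zero)

theorem inner_f_f {j k : ℕ} (hj : 1 ≤ j) (hk : 1 ≤ k) :
    inner ℝ (f j) (f k) = if j = k then (1 : ℝ) else 0 := by
  rw [f, inner_ofL2_f _ hk, integral_congr_ae (g := fun ξ => fFun j ξ * fFun k ξ)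
    (by filter_upwards [(memLp_fFun j).coeFn_toLp] with ξ hξ; rw [hξ]), integral_fFun_mul_fFun hj]
  split_ifs with h
  · exact inv_mul_cancel₀ (natCast_mul_pi_sq_ne_zero hk)
  · simp

/-- Completeness of the f_k. Reading the inner product as f_k evaluated at B⁻¹x replaces the
functional `x` by the genuine function B⁻¹x, whose cosine coefficients all vanish; the coefficient k
= 0 is its mean. -/
theorem eq_zero_of_inner_f_eq_zero {x : H} (h : ∀ k : ℕ, 1 ≤ k → inner ℝ x (f k) = 0) : x = 0 := by
  have hz : B.symm x = 0 := by
    refine V.eq_zero_of_fn_ae_eq_zero (ae_eq_zero_of_integral_cos (integrable_L2 _) fun k => ?_)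
    rcases Nat.eq_zero_or_pos k with rfl | hk
    · simpa using V.integral_eq_zero (B.symm x)
    · have h1 := h k hk
      rw [real_inner_comm, H.inner_def, f, ofL2_apply] at h1
      have h2 : ∫ ξ, (k * Real.pi * √2) * (V.fn (B.symm x) ξ * Real.cos (k * Real.pi * ξ)) ∂vol01
          = 0 := by
        rw [← h1]
        refine integral_congr_ae ?_
        filter_upwards [(memLp_fFun k).coeFn_toLp] with ξ h
        rw [h, fFun]; ring
      rw [integral_const_mul] at h2
      refine (mul_eq_zero.1 h2).resolve_left ?_
      have : (k : ℝ) ≠ 0 := by exact_mod_cast (by omega : k ≠ 0)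
      have := Real.pi_ne_zero
      positivity
  rw [← B.apply_symm_apply x, hz, map_zero]

theorem orthonormal_f : Orthonormal ℝ (fun i : ℕ => f (i + 1)) := by
  rw [orthonormal_iff_ite]
  intro i j
  rw [inner_f_f (by omega) (by omega)]
  simp

/-- The Hilbert basis `f_1, f_2, …` of `H`. -/
noncomputable def basisH : HilbertBasis ℕ ℝ H :=
  HilbertBasis.mkOfOrthogonalEqBot orthonormal_f (by
    rw [Submodule.eq_bot_iff]
    intro x hx
    refine eq_zero_of_inner_f_eq_zero fun k hk => ?_
    obtain ⟨i, rfl⟩ : ∃ i, k = i + 1 := ⟨k - 1, by omega⟩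
    rw [real_inner_comm]
    exact (Submodule.mem_orthogonal _ _).1 hx _ (Submodule.subset_span ⟨i, rfl⟩))

theorem basisH_apply (i : ℕ) : basisH i = f (i + 1) := by
  simp [basisH]

/-! ### The projections P_n and the spectrum of Q. -/

theorem P_eq_sum_range (n : ℕ) (x : H) :
    P n x = ∑ i ∈ Finset.range n, inner ℝ x (f (i + 1)) • f (i + 1) := by
  rw [P, ← Finset.sum_image (f := fun k => inner ℝ x (f k) • f k) (g := fun i => i + 1)
    (by intro a _ b _ h; simpa using h)]
  congr 1
  ext k
  simp only [Finset.mem_Icc, Finset.mem_image, Finset.mem_range]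
  constructor
  · intro h; exact ⟨k - 1, by omega, by omega⟩
  · rintro ⟨a, h, rfl⟩; omega

theorem tendsto_P (x : H) : Tendsto (fun n => P n x) atTop (𝓝 x) := by
  have := (basisH.hasSum_repr x).tendsto_sum_nat
  simp only [HilbertBasis.repr_apply_apply, basisH_apply] at this
  simpa only [P_eq_sum_range, real_inner_comm] using this

theorem inner_P_f {n k : ℕ} (hk : 1 ≤ k) (x : H) :
    inner ℝ (P n x) (f k) = if k ≤ n then inner ℝ x (f k) else 0 := by
  rw [P, sum_inner]
  have : ∀ j ∈ Finset.Icc 1 n, inner ℝ (inner ℝ x (f j) • f j) (f k) =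
      if j = k then inner ℝ x (f j) else 0 := by
    intro j hj
    rw [real_inner_smul_left, inner_f_f (Finset.mem_Icc.1 hj).1 hk]
    simp
  rw [Finset.sum_congr rfl this, Finset.sum_ite_eq']
  simp [hk]

theorem eq_of_inner_f_eq {x y : H} (h : ∀ k : ℕ, 1 ≤ k → inner ℝ x (f k) = inner ℝ y (f k)) :
    x = y := by
  rw [← sub_eq_zero]
  refine eq_zero_of_inner_f_eq_zero fun k hk => ?_
  rw [inner_sub_left, h k hk, sub_self]

/-- Pythagoras: x - P_n x is orthogonal to P_n x. -/
theorem norm_P_le (n : ℕ) (x : H) : ‖P n x‖ ≤ ‖x‖ := by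
  have h1 : inner ℝ (P n x) (x - P n x) = 0 := by
    conv_lhs => arg 2; rw [P]
    rw [sum_inner]
    refine Finset.sum_eq_zero fun k hk => ?_
    rw [Finset.mem_Icc] at hk
    rw [real_inner_smul_left, inner_sub_right, real_inner_comm x (f k),
      real_inner_comm (P n x) (f k), inner_P_f hk.1, if_pos hk.2, sub_self, mul_zero]
  have h2 := norm_add_sq_eq_norm_sq_add_norm_sq_real h1
  rw [add_sub_cancel] at h2
  nlinarith [norm_nonneg x, norm_nonneg (P n x), mul_self_nonneg ‖x - P n x‖]

theorem P_sub (n : ℕ) (x y : H) : P n (x - y) = P n x - P n y := by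
  simp only [P, inner_sub_left, sub_smul, Finset.sum_sub_distrib]

theorem Binv_f {k : ℕ} (hk : 1 ≤ k) : Binv (f k) = ((k * Real.pi) ^ 2)⁻¹ • f k := by
  change ofL2 (V.fn (B.symm (f k))) = _
  rw [f, ← map_smul]
  congr 1
  refine Lp.ext ?_
  filter_upwards [fn_symm_f hk, (memLp_fFun k).coeFn_toLp,
    Lp.coeFn_smul ((((k : ℝ) * Real.pi) ^ 2)⁻¹) (memLp_fFun k).toLp] with ξ h1 h2 h3
  rw [f] at h1
  rw [h1, h3, Pi.smul_apply, h2, smul_eq_mul]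

theorem sqrt_eig {k : ℕ} : √(eig k) = (√2)⁻¹ * ((k * Real.pi) ^ 2)⁻¹ := by
  have : eig k = ((√2)⁻¹ * ((k * Real.pi) ^ 2)⁻¹) ^ 2 := by
    rw [mul_pow, inv_pow, Real.sq_sqrt (by norm_num), eig]
    field_simp
  rw [this, Real.sqrt_sq (by positivity)]

theorem Qhalf_f {k : ℕ} (hk : 1 ≤ k) : Qhalf (f k) = √(eig k) • f k := by
  rw [Qhalf, _root_.smul_apply, Binv_f hk, smul_smul, sqrt_eig]

theorem eig_pos {k : ℕ} (hk : 1 ≤ k) : 0 < eig k := by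
  have : (0 : ℝ) < k := by exact_mod_cast hk
  have := Real.pi_pos
  unfold eig; positivity

theorem Q_f {k : ℕ} (hk : 1 ≤ k) : Q (f k) = eig k • f k := by
  rw [← Qhalf_comp_Qhalf, ContinuousLinearMap.comp_apply, Qhalf_f hk, map_smul, Qhalf_f hk,
    smul_smul, Real.mul_self_sqrt (eig_pos hk).le]

theorem inner_Qhalf_left (x y : H) : inner ℝ (Qhalf x) y = inner ℝ x (Qhalf y) :=
  Qhalf_isPositive.1 x y

/-- The space `H` is isometric to L²(0,1) through `B` and the derivative. -/
instance : SecondCountableTopology H := by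
  have : Fact ((2 : ℝ≥0∞) ≠ ⊤) := ⟨by norm_num⟩
  have h1 : SecondCountableTopology L2 := inferInstance
  let e : V ≃ₗᵢ[ℝ] L2 := LinearIsometryEquiv.ofSurjective ⟨V.dn, V.norm_dn⟩ V.dn_surjective
  exact ((B.symm.trans e).toHomeomorph).secondCountableTopology

/-! ### Functions representing elements of `H` -/

theorem Represents.mono {p q : ℝ≥0∞} {g : ℝ → ℝ} {x : H} (h : Represents p g x) (hqp : q ≤ p) :
    Represents q g x := ⟨h.1.mono_exponent hqp, h.2⟩

/-- A functional on `V` sees only mean-zero functions. Subtracting its mean from a test function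
gives an element of `V`, and the correction pairs to zero because a representative has zero mean. -/
theorem Represents.ae_eq {g g' : ℝ → ℝ} {x : H} (h : Represents 1 g x) (h' : Represents 1 g' x) :
    g =ᵐ[vol01] g' := by
  have hi := memLp_one_iff_integrable.1 h.1
  have hi' := memLp_one_iff_integrable.1 h'.1
  suffices hz : (fun ξ => g ξ - g' ξ) =ᵐ[vol01] 0 by
    filter_upwards [hz] with ξ hξ
    exact sub_eq_zero.1 hξ
  refine ae_eq_zero_of_test (hi.sub hi') fun φ h1 _ _ => ?_
  have hφ : ContDiff ℝ 1 φ := h1.of_le (by simp)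
  set m := ∫ ξ, φ ξ ∂vol01 with hm
  have hy0 : ∫ ξ, φ ξ - m ∂vol01 = 0 := by
    rw [integral_sub (integrable_of_continuous hφ.continuous) (integrable_const _)]
    simp [hm]
  set y := V.ofContDiff (fun ξ => φ ξ - m) (hφ.sub contDiff_const) hy0
  have key : ∀ u : ℝ → ℝ, Represents 1 u x → x y = ∫ ξ, u ξ * φ ξ ∂vol01 := by
    intro u hu
    have hui := memLp_one_iff_integrable.1 hu.1
    rw [hu.2.2 y]
    have : ∫ ξ, u ξ * V.fn y ξ ∂vol01 = ∫ ξ, u ξ * φ ξ - u ξ * m ∂vol01 := by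
      refine integral_congr_ae ?_
      filter_upwards [V.fn_ofContDiff (hφ.sub contDiff_const) hy0] with ξ hξ
      rw [hξ]; ring
    rw [this, integral_sub (integrable_continuous_mul hui hφ.continuous) (hui.mul_const m),
      integral_mul_const, hu.2.1]
    simp
  simp only [sub_mul]
  rw [integral_sub (integrable_continuous_mul hi hφ.continuous)
    (integrable_continuous_mul hi' hφ.continuous), ← key g h, ← key g' h', sub_self]

theorem toFun_ae_eq {g : ℝ → ℝ} {x : H} (h : Represents 1 g x) : toFun x =ᵐ[vol01] g := by
  have hex : ∃ g, Represents 1 g x := ⟨g, h⟩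
  rw [toFun, dif_pos hex]
  exact hex.choose_spec.ae_eq h

theorem U_eq_of_represents {Φ : ℝ → ℝ} {p₂ : ℝ} (h1 : 0 ≤ p₂) {g : ℝ → ℝ} {x : H}
    (h : Represents (ENNReal.ofReal (p₂ + 1)) g x) :
    U Φ p₂ x = ((∫ ξ, Φ (g ξ) ∂vol01 : ℝ) : EReal) := by
  rw [U, if_pos ⟨g, h⟩]
  have hle : (1 : ℝ≥0∞) ≤ ENNReal.ofReal (p₂ + 1) := by
    rw [ENNReal.one_le_ofReal]; linarith
  rw [integral_congr_ae (g := fun ξ => Φ (g ξ))]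
  filter_upwards [toFun_ae_eq (h.mono hle)] with ξ hξ
  rw [hξ]

theorem represents_P (n : ℕ) (x : H) (p : ℝ≥0∞) :
    Represents p (fun ξ => ∑ k ∈ Finset.Icc 1 n, inner ℝ x (f k) * fFun k ξ) (P n x) := by
  have hc := continuous_fFun
  refine ⟨memLp_of_continuous (by fun_prop) p, ?_, fun y => ?_⟩
  · rw [integral_finsetSum _ fun k _ => (integrable_of_continuous (hc k)).const_mul _]
    refine Finset.sum_eq_zero fun k hk => ?_
    rw [integral_const_mul, integral_fFun (Finset.mem_Icc.1 hk).1, mul_zero]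
  · have hL : P n x y = ∑ k ∈ Finset.Icc 1 n, inner ℝ x (f k) * f k y := by
      let ev : H →+ ℝ := ⟨⟨fun z => z y, rfl⟩, fun _ _ => rfl⟩
      change ev (P n x) = _
      rw [P, map_sum]
      rfl
    simp_rw [Finset.sum_mul]
    rw [hL, integral_finsetSum]
    · refine Finset.sum_congr rfl fun k _ => ?_
      rw [f, ofL2_apply, ← integral_const_mul]
      refine integral_congr_ae ?_
      filter_upwards [(memLp_fFun k).coeFn_toLp] with ξ h
      rw [h]; ring
    · intro k _
      have := (integrable_continuous_mul (integrable_L2 (V.fn y)) (hc k)).const_mul (inner ℝ x (f k))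
      refine this.congr (Eventually.of_forall fun ξ => ?_)
      simp only; ring

theorem U_P (Φ : ℝ → ℝ) {p₂ : ℝ} (h1 : 0 ≤ p₂) (n : ℕ) (x : H) :
    U Φ p₂ (P n x) = (Un Φ n x : EReal) :=
  U_eq_of_represents h1 (represents_P n x _)

/-! ### Mixed norms and convergence in `L^q` -/

section Lq

variable {X Y Ω : Type*} {mX : MeasurableSpace X} {mY : MeasurableSpace Y}
  {mΩ : MeasurableSpace Ω}

/-- Tonelli applied to a sectionwise bound. The target `E` is general because the lemma serves both
the real functionals ∫ h(x,ξ) dξ and the `H`-valued gradients. -/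
theorem eLpNorm_le_eLpNorm_prod {E : Type*} [NormedAddCommGroup E] {μ : Measure X} {ρ : Measure Y}
    [SFinite μ] [SFinite ρ] {h : X × Y → ℝ} (hh : AEStronglyMeasurable h (μ.prod ρ)) {q : ℝ≥0∞}
    (hq0 : q ≠ 0) (hq : q ≠ ⊤) {c : ℝ≥0∞} (hc : c ≠ ⊤) {F : X → E}
    (hF : ∀ᵐ x ∂μ, ‖F x‖ₑ ≤ c * eLpNorm (fun y => h (x, y)) q ρ) :
    eLpNorm F q μ ≤ c * eLpNorm h q (μ.prod ρ) := by
  have hq' : 0 < q.toReal := ENNReal.toReal_pos hq0 hq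
  rw [eLpNorm_eq_lintegral_rpow_enorm_toReal hq0 hq, eLpNorm_eq_lintegral_rpow_enorm_toReal hq0 hq,
    lintegral_prod _ (hh.enorm.pow_const _)]
  have h1 : ∫⁻ x, ‖F x‖ₑ ^ q.toReal ∂μ ≤
      ∫⁻ x, c ^ q.toReal * ∫⁻ y, ‖h (x, y)‖ₑ ^ q.toReal ∂ρ ∂μ := by
    refine lintegral_mono_ae ?_
    filter_upwards [hF] with x hx
    rw [eLpNorm_eq_lintegral_rpow_enorm_toReal hq0 hq] at hx
    refine (ENNReal.rpow_le_rpow hx hq'.le).trans (le_of_eq ?_)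
    rw [ENNReal.mul_rpow_of_nonneg _ _ hq'.le, ← ENNReal.rpow_mul, one_div,
      inv_mul_cancel₀ hq'.ne', ENNReal.rpow_one]
  rw [lintegral_const_mul' _ _ (ENNReal.rpow_ne_top_of_nonneg hq'.le hc)] at h1
  refine (ENNReal.rpow_le_rpow h1 (by positivity)).trans (le_of_eq ?_)
  rw [ENNReal.mul_rpow_of_nonneg _ _ (by positivity), ← ENNReal.rpow_mul, one_div,
    mul_inv_cancel₀ hq'.ne', ENNReal.rpow_one]

theorem eLpNorm_prod_le {μ : Measure X} {ρ : Measure Y}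
    [SFinite μ] [IsProbabilityMeasure ρ] {h : X × Y → ℝ}
    (hh : AEStronglyMeasurable h (μ.prod ρ)) {q : ℝ≥0∞}
    (hq0 : q ≠ 0) (hq : q ≠ ⊤) {K : ℝ≥0∞} (hK : ∀ y, eLpNorm (fun x => h (x, y)) q μ ≤ K) :
    eLpNorm h q (μ.prod ρ) ≤ K := by
  have hq' : 0 < q.toReal := ENNReal.toReal_pos hq0 hq
  rw [eLpNorm_eq_lintegral_rpow_enorm_toReal hq0 hq, lintegral_prod_symm _ (hh.enorm.pow_const _),
    one_div, ENNReal.rpow_inv_le_iff hq']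
  refine (lintegral_mono (g := fun _ => K ^ q.toReal) fun y => ?_).trans (by simp)
  have := hK y
  rwa [eLpNorm_eq_lintegral_rpow_enorm_toReal hq0 hq, one_div, ENNReal.rpow_inv_le_iff hq'] at this

theorem MemLp.ae_memLp_prodMk {μ : Measure X} {ρ : Measure Y} [SFinite μ] [SFinite ρ]
    {h : X × Y → ℝ} {q : ℝ≥0∞} (hq0 : q ≠ 0) (hq : q ≠ ⊤) (hh : MemLp h q (μ.prod ρ)) :
    ∀ᵐ x ∂μ, MemLp (fun y => h (x, y)) q ρ := by
  have h1 := hh.1.prodMk_left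
  have h2 := hh.2
  have hm : AEMeasurable (fun z => ‖h z‖ₑ ^ q.toReal) (μ.prod ρ) := hh.1.enorm.pow_const _
  rw [eLpNorm_lt_top_iff_lintegral_rpow_enorm_lt_top hq0 hq, lintegral_prod _ hm] at h2
  filter_upwards [h1, ae_lt_top' hm.lintegral_prod_right' h2.ne] with x hx1 hx2
  exact ⟨hx1, (eLpNorm_lt_top_iff_lintegral_rpow_enorm_lt_top hq0 hq).2 hx2⟩

theorem enorm_integral_le_eLpNorm {ρ : Measure Y} [IsProbabilityMeasure ρ] {g : Y → ℝ}
    (hg : AEStronglyMeasurable g ρ) {q : ℝ≥0∞} (hq : 1 ≤ q) :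
    ‖∫ y, g y ∂ρ‖ₑ ≤ eLpNorm g q ρ :=
  (enorm_integral_le_lintegral_enorm _).trans <| by
    rw [← eLpNorm_one_eq_lintegral_enorm]
    exact eLpNorm_le_eLpNorm_of_exponent_le hq hg

theorem eLpNorm_integral_le {μ : Measure X} {ρ : Measure Y} [SFinite μ] [IsProbabilityMeasure ρ]
    {h : X × Y → ℝ} (hh : AEStronglyMeasurable h (μ.prod ρ)) {q : ℝ≥0∞} (hq1 : 1 ≤ q)
    (hq : q ≠ ⊤) : eLpNorm (fun x => ∫ y, h (x, y) ∂ρ) q μ ≤ eLpNorm h q (μ.prod ρ) := by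
  rw [← one_mul (eLpNorm h q _)]
  refine eLpNorm_le_eLpNorm_prod hh (by positivity) hq ENNReal.one_ne_top ?_
  filter_upwards [hh.prodMk_left] with x hx
  rw [one_mul]
  exact enorm_integral_le_eLpNorm hx hq1

/-- Boundedness in `L^{2q}` implies uniform integrability in `L^q`. -/
theorem unifIntegrable_of_eLpNorm_le {ν : Measure Ω} {g : ℕ → Ω → ℝ} {q : ℝ≥0∞} (hq1 : 1 ≤ q)
    (hq : q ≠ ⊤) (hg : ∀ n, AEStronglyMeasurable (g n) ν) {K : ℝ≥0∞} (hK : K ≠ ⊤)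
    (hgK : ∀ n, eLpNorm (g n) (q * 2) ν ≤ K) : UnifIntegrable g q ν := by
  lift K to NNReal using hK
  refine unifIntegrable_of hq1 hq hg fun ε hε => ?_
  -- On the set where |g| ≥ C one has |g| ≤ |g|²/C, and the L^q norm of |g|²/C is at most K²/C. The
  -- `+ 1` keeps C positive.
  set C : NNReal := (K ^ 2 + 1) / ε.toNNReal with hC
  have hC0 : 0 < C := div_pos (by positivity) (Real.toNNReal_pos.2 hε)
  refine ⟨C, fun n => ?_⟩
  have h1 : eLpNorm ({ x | C ≤ ‖g n x‖₊ }.indicator (g n)) q ν ≤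
      eLpNorm ((C⁻¹ : ℝ) • fun x => ‖g n x‖ ^ (2 : ℝ)) q ν := by
    refine eLpNorm_mono fun x => ?_
    by_cases hx : C ≤ ‖g n x‖₊
    · have hx' : (C : ℝ) ≤ ‖g n x‖ := hx
      have hC0' : (0 : ℝ) < C := hC0
      rw [indicator_of_mem (by exact hx)]
      simp only [Pi.smul_apply, smul_eq_mul, Real.rpow_two]
      rw [Real.norm_of_nonneg (by positivity : 0 ≤ (C : ℝ)⁻¹ * ‖g n x‖ ^ 2), inv_mul_eq_div,
        le_div_iff₀ hC0']
      nlinarith [norm_nonneg (g n x)]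
    · rw [indicator_of_notMem (by exact hx), norm_zero]
      exact norm_nonneg _
  refine h1.trans ?_
  rw [eLpNorm_const_smul, eLpNorm_norm_rpow _ (by norm_num)]
  have h2 : eLpNorm (g n) (q * ENNReal.ofReal 2) ν ^ (2 : ℝ) ≤ (K : ℝ≥0∞) ^ (2 : ℝ) := by
    rw [ENNReal.ofReal_ofNat]
    exact ENNReal.rpow_le_rpow (hgK n) (by norm_num)
  refine (mul_le_mul_right h2 _).trans ?_
  have e1 : ‖(C⁻¹ : ℝ)‖ₑ = ENNReal.ofReal ((C : ℝ)⁻¹) := Real.enorm_of_nonneg (by positivity)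
  have e2 : (K : ℝ≥0∞) ^ (2 : ℝ) = ENNReal.ofReal ((K : ℝ) ^ 2) := by
    rw [ENNReal.rpow_two, ENNReal.ofReal_pow K.coe_nonneg, ENNReal.ofReal_coe_nnreal]
  rw [e1, e2, ← ENNReal.ofReal_mul (by positivity)]
  refine ENNReal.ofReal_le_ofReal ?_
  have e3 : (C : ℝ) = ((K : ℝ) ^ 2 + 1) / ε := by simp [hC, hε.le]
  rw [e3, inv_div, div_mul_eq_mul_div, div_le_iff₀ (by positivity)]
  nlinarith

theorem eLpNorm_comp_le {ν : Measure Ω} [IsProbabilityMeasure ν] {T : Ω → ℝ}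
    (hT : AEStronglyMeasurable T ν) {F : ℝ → ℝ} {A : ℝ} {N : ℕ} (hN : N ≠ 0)
    (hA : 0 ≤ A) (hF : ∀ t, |F t| ≤ A * (1 + |t| ^ N)) {q : ℝ≥0∞} (hq : 1 ≤ q) :
    eLpNorm (fun z => F (T z)) q ν ≤ ENNReal.ofReal A * (1 + eLpNorm T (q * N) ν ^ N) := by
  have h1 : eLpNorm (fun z => F (T z)) q ν ≤
      eLpNorm (A • ((fun _ => (1 : ℝ)) + fun z => ‖T z‖ ^ (N : ℝ))) q ν := by
    refine eLpNorm_mono fun z => ?_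
    simp only [Pi.smul_apply, Pi.add_apply, smul_eq_mul, Real.rpow_natCast, Real.norm_eq_abs]
    rw [abs_of_nonneg (by positivity : 0 ≤ A * (1 + |T z| ^ N))]
    exact hF _
  refine h1.trans ?_
  rw [eLpNorm_const_smul, Real.enorm_of_nonneg hA]
  refine mul_le_mul_right ((eLpNorm_add_le aestronglyMeasurable_const
    (by simpa only [Real.rpow_natCast, ← Pi.pow_def] using hT.norm.pow N) hq).trans ?_) _
  rw [eLpNorm_norm_rpow _ (by positivity), eLpNorm_const _ (by positivity) (NeZero.ne ν)]
  simp

theorem memLp_comp {ν : Measure Ω} [IsProbabilityMeasure ν] {T : Ω → ℝ}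
    (hT : ∀ q : ℕ, MemLp T q ν) {F : ℝ → ℝ} (hFc : Continuous F) {A : ℝ} {N : ℕ} (hN : N ≠ 0)
    (hA : 0 ≤ A) (hF : ∀ t, |F t| ≤ A * (1 + |t| ^ N)) {q : ℕ} (hq : 1 ≤ q) :
    MemLp (fun z => F (T z)) q ν := by
  have hT1 := (hT 1).1
  refine ⟨hFc.comp_aestronglyMeasurable hT1, (eLpNorm_comp_le hT1 hN hA hF
    (by exact_mod_cast hq)).trans_lt ?_⟩
  have := (hT (q * N)).2
  push_cast at this
  exact ENNReal.mul_lt_top ENNReal.ofReal_lt_top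
    (ENNReal.add_lt_top.2 ⟨ENNReal.one_lt_top, ENNReal.pow_lt_top this⟩)

/-- If `T_n → T` in measure with all moments bounded and `F_n → F` locally uniformly with
polynomial growth, then `F_n ∘ T_n → F ∘ T` in `L^q`. -/
theorem tendsto_eLpNorm_comp {ν : Measure Ω} [IsProbabilityMeasure ν] {T : ℕ → Ω → ℝ}
    {T' : Ω → ℝ} (hT : ∀ n, AEStronglyMeasurable (T n) ν)
    (hTb : ∀ q : ℕ, ∃ K : ℝ≥0∞, K ≠ ⊤ ∧ ∀ n, eLpNorm (T n) q ν ≤ K)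
    (hT' : ∀ q : ℕ, MemLp T' q ν) (hlim : TendstoInMeasure ν T atTop T')
    {F : ℕ → ℝ → ℝ} {F' : ℝ → ℝ} (hFc : ∀ n, Continuous (F n)) (hFc' : Continuous F')
    {A : ℝ} {N : ℕ} (hN : N ≠ 0) (hA : 0 ≤ A) (hF : ∀ n t, |F n t| ≤ A * (1 + |t| ^ N))
    (hF' : ∀ t, |F' t| ≤ A * (1 + |t| ^ N))
    (hcv : ∀ t, Tendsto (fun p : ℕ × ℝ => F p.1 p.2) (atTop ×ˢ 𝓝 t) (𝓝 (F' t)))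
    {q : ℕ} (hq : 1 ≤ q) :
    Tendsto (fun n => eLpNorm (fun z => F n (T n z) - F' (T' z)) q ν) atTop (𝓝 0) := by
  have hq' : (1 : ℝ≥0∞) ≤ q := by exact_mod_cast hq
  -- Along a further subsequence the T_n converge almost everywhere; the moment bounds give uniform
  -- integrability, and Vitali's theorem applies.
  refine tendsto_of_subseq_tendsto fun ns hns => ?_
  obtain ⟨ms, hms, hae⟩ :=
    TendstoInMeasure.exists_seq_tendsto_ae fun ε hε => (hlim ε hε).comp hns
  refine ⟨ms, ?_⟩
  have hidx : Tendsto (fun i => ns (ms i)) atTop atTop := hns.comp hms.tendsto_atTop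
  obtain ⟨K, hK, hTK⟩ := hTb (q * 2 * N)
  have hmeas : ∀ i, AEStronglyMeasurable (fun z => F (ns (ms i)) (T (ns (ms i)) z)) ν :=
    fun i => (hFc _).comp_aestronglyMeasurable (hT _)
  refine tendsto_Lp_finite_of_tendsto_ae (f := fun i z => F (ns (ms i)) (T (ns (ms i)) z)) hq'
    (ENNReal.natCast_ne_top q) hmeas (memLp_comp hT' hFc' hN hA hF' hq) ?_ ?_
  · refine unifIntegrable_of_eLpNorm_le (K := ENNReal.ofReal A * (1 + K ^ N)) hq'
      (ENNReal.natCast_ne_top q) hmeas ?_ fun i => ?_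
    · exact ENNReal.mul_ne_top ENNReal.ofReal_ne_top
        (ENNReal.add_ne_top.2 ⟨ENNReal.one_ne_top, ENNReal.pow_ne_top hK⟩)
    · refine (eLpNorm_comp_le (hT _) hN hA (hF _) (hq'.trans ?_)).trans ?_
      · exact le_mul_of_one_le_right (by positivity) (by norm_num)
      · have := hTK (ns (ms i))
        push_cast at this
        gcongr
  · filter_upwards [hae] with z hz
    -- The function F_n and its argument T_n(z) move together, which is why `hcv` is stated along a
    -- product filter.
    exact (hcv (T' z)).comp (hidx.prodMk hz)

end Lq

/-! ### The random function `ξ ↦ x(ξ)` -/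

section Field

variable {μ : Measure H}

theorem map_inner_eq_gaussianReal (hμ : IsCenteredGaussian Q μ) (z : H) :
    μ.map (fun x => inner ℝ x z) = gaussianReal 0 (inner ℝ (Q z) z).toNNReal := by
  have := hμ.isGaussian
  have h1 : (fun x : H => inner ℝ x z) = innerSL ℝ z := by
    ext x; exact real_inner_comm _ _
  have h2 : ∫ x, innerSL ℝ z x ∂μ = 0 := by rw [← h1]; exact hμ.mean z
  have h3 : Var[innerSL ℝ z; μ] = inner ℝ (Q z) z := by
    rw [variance_of_integral_eq_zero (by fun_prop) h2, ← hμ.cov z z, ← h1]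
    simp only [sq]
  rw [h1, IsGaussian.map_eq_gaussianReal, h2, h3]

/-- The law of ⟨x, z⟩ is the standard Gaussian scaled by the square root of ⟨Qz, z⟩, so variance
bounds control all L^q norms at once. -/
theorem eLpNorm_inner (hμ : IsCenteredGaussian Q μ) (z : H) (q : ℝ≥0∞) :
    eLpNorm (fun x => inner ℝ x z) q μ =
      ENNReal.ofReal (√(inner ℝ (Q z) z)) * eLpNorm id q (gaussianReal 0 1) := by
  have hnn : 0 ≤ inner ℝ (Q z) z := by
    rw [← hμ.cov z z]; exact integral_nonneg fun x => mul_self_nonneg _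
  have e1 : eLpNorm (fun x => inner ℝ x z) q μ =
      eLpNorm id q (gaussianReal 0 (inner ℝ (Q z) z).toNNReal) := by
    rw [← map_inner_eq_gaussianReal hμ, eLpNorm_map_measure (by fun_prop) (by fun_prop)]
    rfl
  have e2 : gaussianReal 0 (inner ℝ (Q z) z).toNNReal =
      (gaussianReal 0 1).map (√(inner ℝ (Q z) z) * ·) := by
    rw [gaussianReal_map_const_mul, mul_zero, mul_one]
    congr 1
    ext
    simp [Real.sq_sqrt hnn, hnn]
  rw [e1, e2, eLpNorm_map_measure (by fun_prop) (by fun_prop)]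
  have : id ∘ (√(inner ℝ (Q z) z) * ·) = √(inner ℝ (Q z) z) • (id : ℝ → ℝ) := by
    ext; simp
  rw [this, eLpNorm_const_smul, Real.enorm_of_nonneg (Real.sqrt_nonneg _)]

theorem memLp_inner (hμ : IsCenteredGaussian Q μ) (z : H) {q : ℝ≥0∞} (hq : q ≠ ⊤) :
    MemLp (fun x => inner ℝ x z) q μ := by
  refine ⟨by fun_prop, ?_⟩
  rw [eLpNorm_inner hμ]
  exact ENNReal.mul_lt_top ENNReal.ofReal_lt_top (memLp_id_gaussianReal' q hq).2

/-- The function `(x, ξ) ↦ P_n x(ξ)`. -/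
noncomputable def partialField (n : ℕ) (z : H × ℝ) : ℝ :=
  ∑ k ∈ Finset.Icc 1 n, inner ℝ z.1 (f k) * fFun k z.2

theorem continuous_partialField (n : ℕ) : Continuous (partialField n) := by
  have := continuous_fFun
  unfold partialField; fun_prop

/-- The tail of the series bounding the variance of `x(ξ)`. -/
noncomputable def varTail (m : ℕ) : ℝ := ∑' i : ℕ, 1 / (((i + m : ℕ) : ℝ) + 1) ^ 2

theorem summable_varTail : Summable fun i : ℕ => 1 / ((i : ℝ) + 1) ^ 2 := by
  have := (summable_nat_add_iff 1).2 (Real.summable_one_div_nat_pow.2 one_lt_two)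
  simpa using this

theorem tendsto_varTail : Tendsto varTail atTop (𝓝 0) :=
  tendsto_sum_nat_add fun i : ℕ => 1 / ((i : ℝ) + 1) ^ 2

theorem sum_Ioc_le_varTail {N m n : ℕ} (h : N ≤ m) :
    ∑ k ∈ Finset.Ioc m n, 1 / (k : ℝ) ^ 2 ≤ varTail N := by
  have h1 : ∑ k ∈ Finset.Ioc m n, 1 / (k : ℝ) ^ 2 ≤
      ∑ k ∈ Finset.Ico (N + 1) (n + 1), 1 / (k : ℝ) ^ 2 := by
    refine Finset.sum_le_sum_of_subset_of_nonneg (fun k hk => ?_) fun k _ _ => by positivity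
    simp only [Finset.mem_Ioc, Finset.mem_Ico] at hk ⊢
    omega
  refine h1.trans ?_
  rw [Finset.sum_Ico_eq_sum_range, varTail]
  have hs := (summable_nat_add_iff N).2 summable_varTail
  refine le_trans (le_of_eq (Finset.sum_congr rfl fun i _ => ?_)) (hs.sum_le_tsum
    (Finset.range (n + 1 - (N + 1))) fun i _ => by positivity)
  push_cast; ring

/-- At fixed ξ the difference is ⟨x, w⟩ with w = ∑ f_k(ξ) f_k. Its variance ⟨Qw, w⟩ = ∑ λ_k f_k(ξ)²
is at most ∑ 1/k² over the block, a bound free of ξ, so it survives integration over (0,1). -/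
theorem eLpNorm_partialField_sub_le (hμ : IsCenteredGaussian Q μ) {q : ℝ≥0∞} (hq0 : q ≠ 0)
    (hq : q ≠ ⊤) {N m n : ℕ} (hm : N ≤ m) (hn : N ≤ n) :
    eLpNorm (partialField n - partialField m) q (μ.prod vol01) ≤
      ENNReal.ofReal (√(varTail N)) * eLpNorm id q (gaussianReal 0 1) := by
  have := hμ.isGaussian
  wlog hmn : m ≤ n generalizing m n
  · rw [eLpNorm_sub_comm]; exact this hn hm (le_of_not_ge hmn)
  refine eLpNorm_prod_le ((continuous_partialField n).sub
    (continuous_partialField m)).aestronglyMeasurable hq0 hq fun ξ => ?_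
  set w : H := ∑ k ∈ Finset.Ioc m n, fFun k ξ • f k with hw
  have hsub : ∀ x : H, partialField n (x, ξ) - partialField m (x, ξ) = inner ℝ x w := by
    intro x
    have hU : Finset.Icc 1 n = Finset.Icc 1 m ∪ Finset.Ioc m n := by
      ext k; simp only [Finset.mem_Icc, Finset.mem_union, Finset.mem_Ioc]; omega
    rw [partialField, partialField, hU, Finset.sum_union, add_sub_cancel_left, hw, inner_sum]
    · refine Finset.sum_congr rfl fun k _ => ?_
      rw [real_inner_smul_right, mul_comm]
    · rw [Finset.disjoint_left]
      intro k hk hk'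
      simp only [Finset.mem_Icc, Finset.mem_Ioc] at hk hk'
      omega
  simp only [Pi.sub_apply, hsub]
  rw [eLpNorm_inner hμ]
  gcongr
  refine le_trans ?_ (sum_Ioc_le_varTail (n := n) hm)
  have hinner : ∀ k ∈ Finset.Ioc m n, inner ℝ (f k) w = fFun k ξ := by
    intro k hk
    have hk' := Finset.mem_Ioc.1 hk
    rw [hw, inner_sum]
    have : ∀ j ∈ Finset.Ioc m n, inner ℝ (f k) (fFun j ξ • f j) =
        if k = j then fFun j ξ else 0 := by
      intro j hj
      have hj' := Finset.mem_Ioc.1 hj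
      rw [real_inner_smul_right, inner_f_f (by omega) (by omega)]
      simp
    rw [Finset.sum_congr rfl this, Finset.sum_ite_eq, if_pos hk]
  conv_lhs => arg 2; rw [hw]
  rw [map_sum, sum_inner]
  refine Finset.sum_le_sum fun k hk => ?_
  have hk1 : 1 ≤ k := by have := Finset.mem_Ioc.1 hk; omega
  have hkpos : (0 : ℝ) < k := by exact_mod_cast hk1
  rw [map_smul, Q_f hk1, real_inner_smul_left, real_inner_smul_left, hinner k hk, eig, fFun]
  have h2 : √2 ^ 2 = (2 : ℝ) := Real.sq_sqrt (by norm_num)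
  have hpi := Real.pi_pos
  have e : k * Real.pi * (√2 * Real.cos (k * Real.pi * ξ)) * (1 / (2 * Real.pi ^ 4 * (k : ℝ) ^ 4) *
      (k * Real.pi * (√2 * Real.cos (k * Real.pi * ξ)))) =
      Real.cos (k * Real.pi * ξ) ^ 2 / Real.pi ^ 2 * (1 / (k : ℝ) ^ 2) := by
    field_simp
    rw [h2]
    ring
  rw [e]
  refine mul_le_of_le_one_left (by positivity) ?_
  rw [div_le_one (by positivity)]
  have h3 := Real.cos_sq_le_one (k * Real.pi * ξ)
  have h4 := Real.pi_gt_three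
  nlinarith

/-- `S` is (a version of) the function `(x, ξ) ↦ x(ξ)`: the limit of the `P_n x(ξ)` in all
`L^q(μ × dξ)`. -/
structure IsField (μ : Measure H) (S : H × ℝ → ℝ) : Prop where
  stronglyMeasurable : StronglyMeasurable S
  tendsto : ∀ q : ℕ, 1 ≤ q →
    Tendsto (fun n => eLpNorm (partialField n - S) q (μ.prod vol01)) atTop (𝓝 0)
  memLp : ∀ q : ℕ, MemLp S q (μ.prod vol01)

theorem memLp_partialField (hμ : IsCenteredGaussian Q μ) (q : ℕ) (hq : 1 ≤ q) (n : ℕ) :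
    MemLp (partialField n) q (μ.prod vol01) := by
  have := hμ.isGaussian
  refine ⟨(continuous_partialField n).aestronglyMeasurable, ?_⟩
  have h0 : partialField 0 = 0 := by ext; simp [partialField]
  have := eLpNorm_partialField_sub_le hμ (q := q) (by positivity) (ENNReal.natCast_ne_top q)
    (le_refl 0) (Nat.zero_le n)
  rw [h0, sub_zero] at this
  exact this.trans_lt (ENNReal.mul_lt_top ENNReal.ofReal_lt_top
    (memLp_id_gaussianReal' _ (ENNReal.natCast_ne_top q)).2)

theorem eLpNorm_partialField_le (hμ : IsCenteredGaussian Q μ) (q : ℕ) :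
    ∃ K : ℝ≥0∞, K ≠ ⊤ ∧ ∀ n, eLpNorm (partialField n) q (μ.prod vol01) ≤ K := by
  have := hμ.isGaussian
  rcases Nat.eq_zero_or_pos q with rfl | hq
  · exact ⟨0, by simp, by simp⟩
  refine ⟨ENNReal.ofReal (√(varTail 0)) * eLpNorm id q (gaussianReal 0 1),
    (ENNReal.mul_lt_top ENNReal.ofReal_lt_top
      (memLp_id_gaussianReal' _ (ENNReal.natCast_ne_top q)).2).ne, fun n => ?_⟩
  have h0 : partialField 0 = 0 := by ext; simp [partialField]
  have := eLpNorm_partialField_sub_le hμ (q := q) (by positivity) (ENNReal.natCast_ne_top q)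
    (le_refl 0) (Nat.zero_le n)
  rwa [h0, sub_zero] at this

theorem tendsto_bound {q : ℕ} :
    Tendsto (fun N => ENNReal.ofReal (√(varTail N)) * eLpNorm id q (gaussianReal 0 1))
      atTop (𝓝 0) := by
  have h1 : Tendsto (fun N => ENNReal.ofReal (√(varTail N))) atTop (𝓝 0) := by
    have := (ENNReal.continuous_ofReal.comp Real.continuous_sqrt).tendsto 0
    simp only [Function.comp_apply, Real.sqrt_zero, ENNReal.ofReal_zero] at this
    exact this.comp tendsto_varTail
  have := ENNReal.Tendsto.mul_const (b := eLpNorm id q (gaussianReal 0 1)) h1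
    (Or.inr (memLp_id_gaussianReal' _ (ENNReal.natCast_ne_top q)).2.ne)
  rwa [zero_mul] at this

/-- The limit is constructed once, in L². Convergence in measure and Fatou's lemma transfer the tail
bound to every other q, so the same `S` serves all exponents. -/
theorem exists_isField (hμ : IsCenteredGaussian Q μ) : ∃ S, IsField μ S := by
  have := hμ.isGaussian
  set ν := μ.prod vol01 with hν
  have hfact : Fact ((1 : ℝ≥0∞) ≤ (2 : ℕ)) := ⟨by norm_num⟩
  have hfin : ∀ q : ℕ, eLpNorm id q (gaussianReal 0 1) ≠ ⊤ := fun q =>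
    (memLp_id_gaussianReal' _ (ENNReal.natCast_ne_top q)).2.ne
  have hmem := memLp_partialField hμ 2 (by norm_num)
  have hc : CauchySeq fun n => (hmem n).toLp := by
    refine cauchySeq_of_le_tendsto_0 (fun N => (ENNReal.ofReal (√(varTail N)) *
      eLpNorm id (2 : ℕ) (gaussianReal 0 1)).toReal) (fun n m N hn hm => ?_) ?_
    · rw [Lp.dist_def]
      refine ENNReal.toReal_mono (ENNReal.mul_ne_top ENNReal.ofReal_ne_top (hfin 2)) ?_
      rw [eLpNorm_congr_ae ((hmem n).coeFn_toLp.sub (hmem m).coeFn_toLp)]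
      exact eLpNorm_partialField_sub_le hμ (by norm_num) (by norm_num) hm hn
    · exact (ENNReal.tendsto_toReal ENNReal.zero_ne_top).comp tendsto_bound
  obtain ⟨S', hS⟩ := cauchySeq_tendsto_of_complete hc
  let S : H × ℝ → ℝ := fun z => S' z
  have hS2 : Tendsto (fun n => eLpNorm (partialField n - S) (2 : ℕ) ν) atTop (𝓝 0) := by
    have := (Lp.tendsto_Lp_iff_tendsto_eLpNorm' _ _).1 hS
    refine this.congr fun n => eLpNorm_congr_ae ?_
    exact (hmem n).coeFn_toLp.sub (EventuallyEq.refl _ _)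
  have hmeas := tendstoInMeasure_of_tendsto_eLpNorm (p := (2 : ℕ)) (by norm_num)
    (fun n => (hmem n).1) (Lp.stronglyMeasurable S').aestronglyMeasurable hS2
  have hbound : ∀ q : ℕ, 1 ≤ q → ∀ n, eLpNorm (partialField n - S) q ν ≤
      ENNReal.ofReal (√(varTail n)) * eLpNorm id q (gaussianReal 0 1) := by
    intro q hq n
    have h1 : TendstoInMeasure ν (fun m => partialField n - partialField m) atTop
        (partialField n - S) := by
      intro ε hε
      refine (hmeas ε hε).congr fun m => ?_
      simp only [Pi.sub_apply, edist_sub_left]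
      rfl
    refine eLpNorm_le_of_tendstoInMeasure ?_ h1
      (fun m => ((continuous_partialField n).sub (continuous_partialField m)).aestronglyMeasurable)
    filter_upwards [eventually_ge_atTop n] with m hm
    exact eLpNorm_partialField_sub_le hμ (by positivity) (ENNReal.natCast_ne_top q) hm le_rfl
  have htend : ∀ q : ℕ, 1 ≤ q → Tendsto (fun n => eLpNorm (partialField n - S) q ν) atTop (𝓝 0) :=
    fun q hq => tendsto_of_tendsto_of_tendsto_of_le_of_le tendsto_const_nhds tendsto_bound
      (fun _ => zero_le) (hbound q hq)
  refine ⟨S, Lp.stronglyMeasurable S', htend, fun q => ?_⟩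
  rcases Nat.eq_zero_or_pos q with rfl | hq
  · simpa using (Lp.stronglyMeasurable S').aestronglyMeasurable
  · have h1 : MemLp (partialField 0 - S) q ν :=
      ⟨(continuous_partialField 0).aestronglyMeasurable.sub
        (Lp.stronglyMeasurable S').aestronglyMeasurable, (hbound q hq 0).trans_lt
        (ENNReal.mul_lt_top ENNReal.ofReal_lt_top (hfin q).lt_top)⟩
    have h2 := (memLp_partialField hμ q hq 0).sub h1
    simpa using h2

theorem IsField.tendstoInMeasure {S : H × ℝ → ℝ} (hS : IsField μ S) :
    TendstoInMeasure (μ.prod vol01) partialField atTop S :=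
  tendstoInMeasure_of_tendsto_eLpNorm (p := (1 : ℕ)) (by norm_num)
    (fun n => (continuous_partialField n).aestronglyMeasurable)
    hS.stronglyMeasurable.aestronglyMeasurable (hS.tendsto 1 le_rfl)

/-- Used to read off the mean and the cosine coefficients of the sections of `S`: when the pairing
of P_n x with `g` stabilises for large n, L¹ convergence passes its value to the limit. -/
theorem IsField.integral_mul_eq {S : H × ℝ → ℝ} (hS : IsField μ S)
    (hμ : IsCenteredGaussian Q μ) {g : ℝ → ℝ} (hg : Continuous g) {a : H → ℝ} (ha : Continuous a)
    {N : ℕ} (hN : ∀ n, N ≤ n → ∀ x, ∫ ξ, partialField n (x, ξ) * g ξ ∂vol01 = a x) :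
    ∀ᵐ x ∂μ, ∫ ξ, S (x, ξ) * g ξ ∂vol01 = a x := by
  have := hμ.isGaussian
  obtain ⟨C, hC⟩ := isCompact_Icc.exists_bound_of_continuousOn (s := Icc (0 : ℝ) 1) hg.continuousOn
  have hC' : ∀ᵐ ξ ∂vol01, ‖g ξ‖ ≤ C := (ae_restrict_iff' measurableSet_Ioo).2
    (Eventually.of_forall fun ξ hξ => hC ξ (Ioo_subset_Icc_self hξ))
  have hSi : ∀ᵐ x ∂μ, MemLp (fun ξ => S (x, ξ)) (1 : ℕ) vol01 :=
    MemLp.ae_memLp_prodMk (by norm_num) (by norm_num) (hS.memLp 1)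
  have hmeas : AEStronglyMeasurable (fun x => ∫ ξ, S (x, ξ) * g ξ ∂vol01) μ :=
    (hS.stronglyMeasurable.mul
      (hg.comp continuous_snd).stronglyMeasurable).integral_prod_right'.aestronglyMeasurable
  have hle : ∀ n, N ≤ n → eLpNorm (fun x => ∫ ξ, S (x, ξ) * g ξ ∂vol01 - a x) (1 : ℕ) μ ≤
      ENNReal.ofReal C * eLpNorm (partialField n - S) (1 : ℕ) (μ.prod vol01) := by
    intro n hn
    refine eLpNorm_le_eLpNorm_prod ((continuous_partialField n).aestronglyMeasurable.sub
      hS.stronglyMeasurable.aestronglyMeasurable) (by norm_num) (by norm_num)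
      ENNReal.ofReal_ne_top ?_
    filter_upwards [hSi] with x hx
    have hx' : Integrable (fun ξ => S (x, ξ)) vol01 := memLp_one_iff_integrable.1 (by simpa using hx)
    have hPc : Continuous fun ξ => partialField n (x, ξ) :=
      (continuous_partialField n).comp (by fun_prop)
    have hPi : Integrable (fun ξ => partialField n (x, ξ) * g ξ) vol01 :=
      integrable_of_continuous (hPc.mul hg)
    rw [← hN n hn x, ← integral_sub (integrable_continuous_mul hx' hg) hPi, Nat.cast_one, eLpNorm_one_eq_lintegral_enorm,
      ← lintegral_const_mul' _ _ ENNReal.ofReal_ne_top]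
    refine (enorm_integral_le_lintegral_enorm _).trans (lintegral_mono_ae ?_)
    filter_upwards [hC'] with ξ hξ
    rw [← sub_mul, enorm_mul, mul_comm, Pi.sub_apply, enorm_sub_rev]
    gcongr
    rw [← ofReal_norm]
    exact ENNReal.ofReal_le_ofReal hξ
  have h0 : eLpNorm (fun x => ∫ ξ, S (x, ξ) * g ξ ∂vol01 - a x) (1 : ℕ) μ = 0 := by
    have h1 := ENNReal.Tendsto.const_mul (a := ENNReal.ofReal C) (hS.tendsto 1 le_rfl)
      (Or.inr ENNReal.ofReal_ne_top)
    rw [mul_zero] at h1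
    refine le_antisymm (ge_of_tendsto h1 ?_) zero_le
    filter_upwards [eventually_ge_atTop N] with n hn using hle n hn
  filter_upwards [(eLpNorm_eq_zero_iff (hmeas.sub ha.aestronglyMeasurable) (by norm_num)).1 h0] with x hx
  exact sub_eq_zero.1 hx

theorem integral_partialField_mul (n : ℕ) (x : H) {k : ℕ} (hk : 1 ≤ k) (hkn : k ≤ n) :
    ∫ ξ, partialField n (x, ξ) * fFun k ξ ∂vol01 = (k * Real.pi) ^ 2 * inner ℝ x (f k) := by
  have hc := continuous_fFun
  simp only [partialField, Finset.sum_mul, mul_assoc]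
  rw [integral_finsetSum _ fun j _ => integrable_of_continuous (by fun_prop)]
  have : ∀ j ∈ Finset.Icc 1 n, ∫ ξ, inner ℝ x (f j) * (fFun j ξ * fFun k ξ) ∂vol01 =
      if j = k then (k * Real.pi) ^ 2 * inner ℝ x (f j) else 0 := by
    intro j hj
    rw [integral_const_mul, integral_fFun_mul_fFun (Finset.mem_Icc.1 hj).1]
    split_ifs <;> ring
  rw [Finset.sum_congr rfl this, Finset.sum_ite_eq', if_pos (Finset.mem_Icc.2 ⟨hk, hkn⟩)]

/-- For almost every `x`, the section `S(x, ·)` is the function identified with `x`. -/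
theorem IsField.ae_represents {S : H × ℝ → ℝ} (hS : IsField μ S) (hμ : IsCenteredGaussian Q μ) :
    ∀ᵐ x ∂μ, ∀ q : ℕ, 1 ≤ q → Represents q (fun ξ => S (x, ξ)) x := by
  have := hμ.isGaussian
  have h1 : ∀ᵐ x ∂μ, ∀ q : ℕ, 1 ≤ q → MemLp (fun ξ => S (x, ξ)) q vol01 := by
    rw [ae_all_iff]
    intro q
    rcases Nat.eq_zero_or_pos q with rfl | hq
    · simp
    · filter_upwards [MemLp.ae_memLp_prodMk (by positivity) (ENNReal.natCast_ne_top q)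
        (hS.memLp q)] with x hx _ using hx
  have h2 : ∀ᵐ x ∂μ, ∀ k : ℕ, 1 ≤ k →
      ∫ ξ, S (x, ξ) * fFun k ξ ∂vol01 = (k * Real.pi) ^ 2 * inner ℝ x (f k) := by
    rw [ae_all_iff]
    intro k
    by_cases hk : 1 ≤ k
    · filter_upwards [hS.integral_mul_eq hμ (continuous_fFun k) (N := k)
        (a := fun x => (k * Real.pi) ^ 2 * inner ℝ x (f k)) (by fun_prop)
        fun n hn x => integral_partialField_mul n x hk hn] with x hx _ using hx
    · simp [hk]
  have h3 : ∀ᵐ x ∂μ, ∫ ξ, S (x, ξ) * 1 ∂vol01 = 0 :=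
    hS.integral_mul_eq hμ continuous_const (a := fun _ => 0) continuous_const (N := 0)
      fun n _ x => by simpa [partialField] using (represents_P n x 1).2.1
  filter_upwards [h1, h2, h3] with x hx1 hx2 hx3 q hq
  simp only [mul_one] at hx3
  have hm : MemLp (fun ξ => S (x, ξ)) 2 vol01 := by simpa using hx1 2 (by norm_num)
  -- Both sides have the same coordinates against every f_k, so completeness identifies them.
  have hx : x = ofL2 hm.toLp := by
    refine eq_of_inner_f_eq fun k hk => ?_
    rw [inner_ofL2_f _ hk, integral_congr_ae (g := fun ξ => S (x, ξ) * fFun k ξ)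
      (by filter_upwards [hm.coeFn_toLp] with ξ hξ; rw [hξ]), hx2 k hk, ← mul_assoc,
      inv_mul_cancel₀ (natCast_mul_pi_sq_ne_zero hk), one_mul]
  refine ⟨hx1 q hq, hx3, fun y => ?_⟩
  conv_lhs => rw [hx]
  rw [ofL2_apply]
  exact integral_congr_ae (by filter_upwards [hm.coeFn_toLp] with ξ hξ; rw [hξ])

end Field

/-! ### Bounded `C¹` functions -/

/-- `F` is of class `C¹`, bounded with bounded derivative. -/
structure IsC1b {E : Type*} [NormedAddCommGroup E] [NormedSpace ℝ E] (F : E → ℝ) : Prop where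
  contDiff : ContDiff ℝ 1 F
  bdd : ∃ C : ℝ, ∀ x, |F x| ≤ C
  bdd_fderiv : ∃ C : ℝ, ∀ x, ‖fderiv ℝ F x‖ ≤ C

section IsC1b

variable {E E' : Type*} [NormedAddCommGroup E] [NormedSpace ℝ E] [NormedAddCommGroup E']
  [NormedSpace ℝ E']

theorem IsC1b.differentiable {F : E → ℝ} (h : IsC1b F) : Differentiable ℝ F :=
  h.contDiff.differentiable one_ne_zero

theorem IsC1b.continuous {F : E → ℝ} (h : IsC1b F) : Continuous F := h.contDiff.continuous

theorem IsC1b.continuous_fderiv_apply {F : E → ℝ} (h : IsC1b F) (v : E) :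
    Continuous fun x => fderiv ℝ F x v :=
  (h.contDiff.continuous_fderiv one_ne_zero).clm_apply continuous_const

theorem IsC1b.bdd_fderiv_apply {F : E → ℝ} (h : IsC1b F) (v : E) :
    ∃ C : ℝ, ∀ x, |fderiv ℝ F x v| ≤ C := by
  obtain ⟨C, hC⟩ := h.bdd_fderiv
  exact ⟨C * ‖v‖, fun x => (ContinuousLinearMap.le_opNorm _ _).trans
    (mul_le_mul_of_nonneg_right (hC x) (norm_nonneg _))⟩

theorem IsC1b.mul {F G : E → ℝ} (hF : IsC1b F) (hG : IsC1b G) : IsC1b fun x => F x * G x := by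
  obtain ⟨A, hA⟩ := hF.bdd
  obtain ⟨B, hB⟩ := hG.bdd
  obtain ⟨A', hA'⟩ := hF.bdd_fderiv
  obtain ⟨B', hB'⟩ := hG.bdd_fderiv
  refine ⟨hF.contDiff.mul hG.contDiff, ⟨A * B, fun x => ?_⟩, ⟨A * B' + B * A', fun x => ?_⟩⟩
  · rw [abs_mul]
    exact mul_le_mul (hA x) (hB x) (abs_nonneg _) ((abs_nonneg _).trans (hA x))
  · rw [fderiv_fun_mul hF.differentiable.differentiableAt hG.differentiable.differentiableAt]
    refine (norm_add_le _ _).trans ?_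
    rw [norm_smul, norm_smul]
    exact add_le_add
      (mul_le_mul (hA x) (hB' x) (norm_nonneg _) ((abs_nonneg _).trans (hA x)))
      (mul_le_mul (hB x) (hA' x) (norm_nonneg _) ((abs_nonneg _).trans (hB x)))

theorem IsC1b.comp_clm {F : E' → ℝ} (hF : IsC1b F) (L : E →L[ℝ] E') : IsC1b fun x => F (L x) := by
  obtain ⟨A, hA⟩ := hF.bdd
  obtain ⟨A', hA'⟩ := hF.bdd_fderiv
  refine ⟨hF.contDiff.comp L.contDiff, ⟨A, fun x => hA _⟩, ⟨A' * ‖L‖, fun x => ?_⟩⟩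
  rw [show (fun x => F (L x)) = F ∘ L from rfl,
    fderiv_comp x hF.differentiable.differentiableAt L.differentiableAt, L.fderiv]
  exact (ContinuousLinearMap.opNorm_comp_le _ _).trans
    (mul_le_mul_of_nonneg_right (hA' _) (norm_nonneg _))

theorem isC1b_real {g : ℝ → ℝ} (hg : ContDiff ℝ 1 g) (hb : ∃ C, ∀ t, |g t| ≤ C)
    (hd : ∃ C, ∀ t, |deriv g t| ≤ C) : IsC1b g := by
  obtain ⟨C, hC⟩ := hd
  exact ⟨hg, hb, C, fun x => by rw [← norm_deriv_eq_norm_fderiv]; exact hC x⟩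

theorem isC1b_cos : IsC1b Real.cos :=
  isC1b_real Real.contDiff_cos ⟨1, Real.abs_cos_le_one⟩
    ⟨1, fun t => by rw [Real.deriv_cos, abs_neg]; exact Real.abs_sin_le_one t⟩

theorem isC1b_sin : IsC1b Real.sin :=
  isC1b_real Real.contDiff_sin ⟨1, Real.abs_sin_le_one⟩
    ⟨1, fun t => by rw [Real.deriv_sin]; exact Real.abs_cos_le_one t⟩

theorem isC1b_inv_one_add_sq : IsC1b fun t : ℝ => (1 + t ^ 2)⁻¹ := by
  have hpos : ∀ t : ℝ, 0 < 1 + t ^ 2 := fun t => by positivity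
  refine isC1b_real (ContDiff.inv (by fun_prop) fun t => (hpos t).ne') ⟨1, fun t => ?_⟩
    ⟨1, fun t => ?_⟩
  · rw [abs_of_nonneg (by positivity)]
    exact inv_le_one_of_one_le₀ (by nlinarith [sq_nonneg t])
  · have h : HasDerivAt (fun t : ℝ => 1 + t ^ 2) (2 * t) t := by
      simpa using (hasDerivAt_pow 2 t).const_add 1
    rw [(h.fun_inv (hpos t).ne').deriv, abs_div, abs_neg, abs_of_nonneg (by positivity :
      (0 : ℝ) ≤ (1 + t ^ 2) ^ 2), div_le_one (by positivity), abs_le]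
    constructor <;> nlinarith [sq_nonneg (t - 1), sq_nonneg (t + 1), sq_nonneg t, sq_nonneg (t ^ 2)]

end IsC1b

theorem IsCylindrical.isC1b {φ : H → ℝ} (h : IsCylindrical f φ) : IsC1b φ := by
  obtain ⟨n, ϕ, h1, h2, h3, rfl⟩ := h
  have hϕ : IsC1b ϕ := ⟨h1, h2, h3⟩
  have := hϕ.comp_clm (ContinuousLinearMap.pi fun i : Fin n => innerSL ℝ (f (i + 1)))
  convert! this using 3
  ext i
  simp [real_inner_comm]

/-! ### Integration by parts for Gaussian measures -/

/-- The centred Gaussian density g satisfies g'(t) = -t g(t)/v; integrate by parts on ℝ. -/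
theorem integral_deriv_gaussianReal {v : NNReal} (hv : v ≠ 0) {u u' : ℝ → ℝ}
    (hu : ∀ t, HasDerivAt u (u' t) t) (hc : Continuous u') (hb : ∃ C, ∀ t, |u t| ≤ C)
    (hb' : ∃ C, ∀ t, |u' t| ≤ C) :
    ∫ t, u' t ∂gaussianReal 0 v = (v : ℝ)⁻¹ * ∫ t, t * u t ∂gaussianReal 0 v := by
  obtain ⟨C, hC⟩ := hb
  obtain ⟨C', hC'⟩ := hb'
  have hv' : (0 : ℝ) < v := by positivity
  have huc : Continuous u := continuous_iff_continuousAt.2 fun t => (hu t).continuousAt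
  have hg : ∀ t, HasDerivAt (gaussianPDFReal 0 v) 
      (-((v : ℝ)⁻¹ * (t * gaussianPDFReal 0 v t))) t := by
    intro t
    simp only [gaussianPDFReal_def, sub_zero]
    have h1 : HasDerivAt (fun t : ℝ => -t ^ 2 / (2 * v)) (-(2 * t) / (2 * v)) t := by
      simpa using ((hasDerivAt_pow 2 t).neg.div_const (2 * (v : ℝ)))
    convert! (h1.exp.const_mul ((√(2 * Real.pi * v))⁻¹)) using 1
    field_simp
  have hgi : Integrable (gaussianPDFReal 0 v) := integrable_gaussianPDFReal 0 v
  have hti : Integrable fun t => t * gaussianPDFReal 0 v t := by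
    have := (integrable_mul_exp_neg_mul_sq (b := (2 * (v : ℝ))⁻¹) (by positivity)).const_mul
      ((√(2 * Real.pi * v))⁻¹)
    refine this.congr (Eventually.of_forall fun t => ?_)
    simp only [gaussianPDFReal_def, sub_zero]
    rw [mul_left_comm]
    congr 3
    field_simp
  have h1 : Integrable (u * fun t => -((v : ℝ)⁻¹ * (t * gaussianPDFReal 0 v t))) :=
    (hti.const_mul _).neg.bdd_mul (c := C) huc.aestronglyMeasurable (Eventually.of_forall hC)
  have h2 : Integrable (u' * gaussianPDFReal 0 v) :=
    hgi.bdd_mul (c := C') hc.aestronglyMeasurable (Eventually.of_forall hC')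
  have h3 : Integrable (u * gaussianPDFReal 0 v) :=
    hgi.bdd_mul (c := C) huc.aestronglyMeasurable (Eventually.of_forall hC)
  have key := integral_mul_deriv_eq_deriv_mul_of_integrable (fun t _ => hu t) (fun t _ => hg t)
    h1 h2 h3
  rw [integral_gaussianReal_eq_integral_smul hv, integral_gaussianReal_eq_integral_smul hv,
    ← integral_const_mul]
  simp only [smul_eq_mul]
  rw [← neg_inj, ← integral_neg (fun t => (v : ℝ)⁻¹ * _)]
  simp only [mul_comm (gaussianPDFReal 0 v _) (u' _)]
  rw [← key]
  congr 1
  ext t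
  ring

section IBP

variable {μ : Measure H}

/-- The two variables are jointly Gaussian, so zero covariance suffices; it vanishes because f_k is
an eigenvector of `Q` orthogonal to the range of the first map. -/
theorem indepFun_coord (hμ : IsCenteredGaussian Q μ) {k : ℕ} (hk : 1 ≤ k) :
    IndepFun (fun x : H => x - inner ℝ x (f k) • f k) (fun x : H => inner ℝ x (f k)) μ := by
  have := hμ.isGaussian
  have hL : HasGaussianLaw (fun x : H => (x - inner ℝ x (f k) • f k, inner ℝ x (f k))) μ := by
    let L : H →L[ℝ] H × ℝ := (ContinuousLinearMap.id ℝ H -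
      (innerSL ℝ (f k)).smulRight (f k)).prod (innerSL ℝ (f k))
    have := (IsGaussian.hasGaussianLaw_id (μ := μ)).map L
    convert! this using 2 with x
    simp [L, real_inner_comm]
  refine hL.indepFun_of_covariance_inner fun a b => ?_
  set a' : H := a - inner ℝ a (f k) • f k with ha'
  have e1 : ∀ x : H, inner ℝ a (x - inner ℝ x (f k) • f k) = inner ℝ x a' := by
    intro x
    rw [ha', inner_sub_right, inner_sub_right, real_inner_smul_right, real_inner_smul_right,
      real_inner_comm x a, mul_comm]
  have e2 : ∀ x : H, inner ℝ b (inner ℝ x (f k)) = b * inner ℝ x (f k) := by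
    intro x; simp [mul_comm]
  simp only [e1, e2, covariance, hμ.mean, integral_const_mul, mul_zero, sub_zero]
  simp only [mul_left_comm _ b]
  -- Symmetry of `Q` is obtained by moving `Qhalf` across the inner product twice.
  rw [integral_const_mul, hμ.cov, ← Qhalf_comp_Qhalf, ContinuousLinearMap.comp_apply,
    inner_Qhalf_left, inner_Qhalf_left, ← ContinuousLinearMap.comp_apply, Qhalf_comp_Qhalf, Q_f hk,
    real_inner_smul_right, ha', inner_sub_left, real_inner_smul_left, inner_f_f hk hk]
  simp

/-- Write x = X + Y f_k with X and Y independent. For fixed X this is the one-dimensional formula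
along the line in direction f_k, and Fubini integrates over X. -/
theorem integral_fderiv_f (hμ : IsCenteredGaussian Q μ) {k : ℕ} (hk : 1 ≤ k) {F : H → ℝ}
    (hF : IsC1b F) :
    ∫ x, fderiv ℝ F x (f k) ∂μ = (eig k)⁻¹ * ∫ x, inner ℝ x (f k) * F x ∂μ := by
  have := hμ.isGaussian
  set X : H → H := fun x => x - inner ℝ x (f k) • f k with hX
  set Y : H → ℝ := fun x => inner ℝ x (f k) with hY
  have hXm : Measurable X := by rw [hX]; fun_prop
  have hYm : Measurable Y := by rw [hY]; fun_prop
  have hprod := (indepFun_iff_map_prod_eq_prod_map_map hXm.aemeasurable hYm.aemeasurable).1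
    (indepFun_coord hμ hk)
  have hQ : inner ℝ (Q (f k)) (f k) = eig k := by
    rw [Q_f hk, real_inner_smul_left, inner_f_f hk hk]; simp
  have hYlaw : μ.map Y = gaussianReal 0 (eig k).toNNReal := by
    rw [hY, map_inner_eq_gaussianReal hμ, hQ]
  have : IsProbabilityMeasure (μ.map X) := Measure.isProbabilityMeasure_map hXm.aemeasurable
  have hint : ∀ g : H × ℝ → ℝ, Continuous g → Integrable (fun x => g (X x, Y x)) μ →
      ∫ x, g (X x, Y x) ∂μ = ∫ y, ∫ t, g (y, t) ∂gaussianReal 0 (eig k).toNNReal ∂μ.map X := by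
    intro g hg hgi
    have h1 : Integrable g (μ.map fun x => (X x, Y x)) :=
      (integrable_map_measure hg.aestronglyMeasurable (by fun_prop)).2 hgi
    rw [← integral_map (φ := fun x => (X x, Y x)) (by fun_prop) hg.aestronglyMeasurable]
    rw [hprod, hYlaw] at h1 ⊢
    exact integral_prod _ h1
  have hrec : ∀ x, X x + Y x • f k = x := fun x => by simp [hX, hY]
  obtain ⟨C, hC⟩ := hF.bdd
  obtain ⟨C', hC'⟩ := hF.bdd_fderiv_apply (f k)
  have hFc := hF.continuous
  have hFc' := hF.continuous_fderiv_apply (f k)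
  have i1 := hint (fun z => fderiv ℝ F (z.1 + z.2 • f k) (f k))
    (hFc'.comp (f := fun z : H × ℝ => z.1 + z.2 • f k) (by fun_prop)) (by
      simp only [hrec]
      exact Integrable.of_bound hFc'.aestronglyMeasurable C' (Eventually.of_forall hC'))
  have i2 := hint (fun z => z.2 * F (z.1 + z.2 • f k)) (by fun_prop) (by
      simp only [hrec]
      exact ((memLp_one_iff_integrable.1 (memLp_inner hμ (f k) (by norm_num))).mul_bdd (c := C)
        hFc.aestronglyMeasurable (Eventually.of_forall hC)))
  simp only [hrec] at i1 i2
  have hY' : ∀ x, inner ℝ x (f k) = Y x := fun _ => rfl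
  simp only [hY']
  rw [i1, i2, ← integral_const_mul]
  congr 1
  ext y
  have hv : (eig k).toNNReal ≠ 0 := (Real.toNNReal_pos.2 (eig_pos hk)).ne'
  rw [integral_deriv_gaussianReal hv (u := fun t => F (y + t • f k)) (fun t => ?_) (by fun_prop)
    ⟨C, fun t => hC _⟩ ⟨C', fun t => hC' _⟩, Real.coe_toNNReal _ (eig_pos hk).le]
  have hl : HasDerivAt (fun t : ℝ => y + t • f k) (f k) t := by
    simpa using ((hasDerivAt_id t).smul_const (f k)).const_add y
  exact hF.differentiable.differentiableAt.hasFDerivAt.comp_hasDerivAt t hl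

/-! ### Uniqueness of the Sobolev gradient -/

/-- The hypotheses say that the finite measures h⁺μ and h⁻μ have the same characteristic function,
so they coincide. -/
theorem ae_eq_zero_of_integral_cos_sin {h : H → ℝ} [IsFiniteMeasure μ] (hh : Integrable h μ)
    (hcos : ∀ t : H, ∫ x, h x * Real.cos (inner ℝ x t) ∂μ = 0)
    (hsin : ∀ t : H, ∫ x, h x * Real.sin (inner ℝ x t) ∂μ = 0) : h =ᵐ[μ] 0 := by
  have hm : AEMeasurable (fun x => ENNReal.ofReal (h x)) μ := hh.aemeasurable.ennreal_ofReal
  have hm' : AEMeasurable (fun x => ENNReal.ofReal (-h x)) μ := hh.neg.aemeasurable.ennreal_ofReal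
  have hfin := hh.lintegral_lt_top
  have hfin' := hh.neg.lintegral_lt_top
  have f1 : IsFiniteMeasure (μ.withDensity fun x => ENNReal.ofReal (h x)) :=
    isFiniteMeasure_withDensity hfin.ne
  have f2 : IsFiniteMeasure (μ.withDensity fun x => ENNReal.ofReal (-h x)) :=
    isFiniteMeasure_withDensity hfin'.ne
  have heq : (μ.withDensity fun x => ENNReal.ofReal (h x)) =
      μ.withDensity fun x => ENNReal.ofReal (-h x) := by
    refine Measure.ext_of_charFun ?_
    ext t
    have hbd : ∀ g : H → ℝ, Integrable g μ →
        Integrable (fun x => g x • Complex.exp (inner ℝ x t * Complex.I)) μ := by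
      intro g hg
      simp only [Complex.real_smul]
      refine hg.ofReal.mul_bdd (c := 1) (Continuous.aestronglyMeasurable (by fun_prop))
        (Eventually.of_forall fun x => ?_)
      rw [Complex.norm_exp_ofReal_mul_I]
    have hp : Integrable (fun x => (ENNReal.ofReal (h x)).toReal) μ := by
      simpa only [ENNReal.toReal_ofReal'] using hh.pos_part
    have hn : Integrable (fun x => (ENNReal.ofReal (-h x)).toReal) μ := by
      simpa only [ENNReal.toReal_ofReal'] using hh.neg_part
    rw [charFun_apply, charFun_apply,
      integral_withDensity_eq_integral_toReal_smul₀ hm (by simp),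
      integral_withDensity_eq_integral_toReal_smul₀ hm' (by simp), ← sub_eq_zero,
      ← integral_sub (hbd _ hp) (hbd _ hn)]
    have e : ∀ x, (ENNReal.ofReal (h x)).toReal • Complex.exp (inner ℝ x t * Complex.I) -
        (ENNReal.ofReal (-h x)).toReal • Complex.exp (inner ℝ x t * Complex.I) =
        ((h x * Real.cos (inner ℝ x t) : ℝ) : ℂ) +
          ((h x * Real.sin (inner ℝ x t) : ℝ) : ℂ) * Complex.I := by
      intro x
      rw [← sub_smul, Complex.exp_mul_I]
      have : (ENNReal.ofReal (h x)).toReal - (ENNReal.ofReal (-h x)).toReal = h x := by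
        rcases le_total 0 (h x) with h0 | h0
        · rw [ENNReal.toReal_ofReal h0, ENNReal.ofReal_of_nonpos (by linarith)]; simp
        · rw [ENNReal.ofReal_of_nonpos h0, ENNReal.toReal_ofReal (by linarith)]; simp
      rw [this, Complex.real_smul]
      push_cast
      ring
    have hcb : Integrable (fun x => h x * Real.cos (inner ℝ x t)) μ :=
      hh.mul_bdd (c := 1) (Continuous.aestronglyMeasurable (by fun_prop))
        (Eventually.of_forall fun x => Real.abs_cos_le_one _)
    have hsb : Integrable (fun x => h x * Real.sin (inner ℝ x t)) μ :=
      hh.mul_bdd (c := 1) (Continuous.aestronglyMeasurable (by fun_prop))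
        (Eventually.of_forall fun x => Real.abs_sin_le_one _)
    refine (integral_congr_ae (Eventually.of_forall e)).trans ?_
    rw [integral_add hcb.ofReal (hsb.ofReal.mul_const _), integral_mul_const, integral_complex_ofReal,
      integral_complex_ofReal, hcos, hsin]
    simp
  rw [withDensity_eq_iff hm hm' hfin.ne] at heq
  filter_upwards [heq] with x hx
  rcases le_total 0 (h x) with h0 | h0
  · rw [ENNReal.ofReal_of_nonpos (by linarith : -h x ≤ 0), ENNReal.ofReal_eq_zero] at hx
    exact le_antisymm hx h0
  · rw [ENNReal.ofReal_of_nonpos h0, eq_comm, ENNReal.ofReal_eq_zero] at hx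
    exact le_antisymm h0 (neg_nonpos.1 hx)

theorem tendsto_integral_mul_of_eLpNorm [IsProbabilityMeasure μ] {p : ℝ≥0∞} (hp : 1 ≤ p)
    {h : ℕ → H → ℝ} {h' b : H → ℝ} (hh : ∀ m, MemLp (h m) p μ) (hh' : MemLp h' p μ)
    (hb : Continuous b) (hbb : ∃ C, ∀ x, |b x| ≤ C)
    (hlim : Tendsto (fun m => eLpNorm (fun x => h m x - h' x) p μ) atTop (𝓝 0)) :
    Tendsto (fun m => ∫ x, h m x * b x ∂μ) atTop (𝓝 (∫ x, h' x * b x ∂μ)) := by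
  obtain ⟨C, hC⟩ := hbb
  have hi : ∀ g : H → ℝ, MemLp g p μ → Integrable (fun x => g x * b x) μ := fun g hg =>
    (hg.integrable hp).mul_bdd (c := C) hb.aestronglyMeasurable (Eventually.of_forall hC)
  refine tendsto_integral_of_L1' _ (hi h' hh').1 (Eventually.of_forall fun m => hi _ (hh m)) ?_
  have h1 := ENNReal.Tendsto.const_mul (a := ENNReal.ofReal C) hlim (Or.inr ENNReal.ofReal_ne_top)
  rw [mul_zero] at h1
  refine tendsto_of_tendsto_of_tendsto_of_le_of_le tendsto_const_nhds h1 (fun _ => zero_le)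
    fun m => ?_
  refine le_trans ?_ (mul_le_mul_right (eLpNorm_le_eLpNorm_of_exponent_le hp
    ((hh m).sub hh').1) _)
  refine eLpNorm_le_mul_eLpNorm_of_ae_le_mul (Eventually.of_forall fun x => ?_) 1
  simp only [Pi.sub_apply, ← sub_mul, norm_mul, Real.norm_eq_abs]
  rw [mul_comm]
  exact mul_le_mul_of_nonneg_right (hC x) (abs_nonneg _)

theorem sqrt_eig_pos {k : ℕ} (hk : 1 ≤ k) : 0 < √(eig k) := Real.sqrt_pos.2 (eig_pos hk)

theorem norm_f {k : ℕ} (hk : 1 ≤ k) : ‖f k‖ = 1 := by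
  have : ‖f k‖ ^ 2 = 1 := by rw [← real_inner_self_eq_norm_sq, inner_f_f hk hk, if_pos rfl]
  nlinarith [norm_nonneg (f k)]

theorem inner_Qhalf_gradient (φ : H → ℝ) {k : ℕ} (hk : 1 ≤ k) (x : H) :
    inner ℝ (Qhalf (gradient φ x)) (f k) = √(eig k) * fderiv ℝ φ x (f k) := by
  rw [inner_Qhalf_left, Qhalf_f hk, real_inner_smul_right, gradient,
    InnerProductSpace.toDual_symm_apply]

/-- Integration by parts for φψ passes to the limit along the approximating φ. The right-hand side
depends on `u` alone, which is the source of uniqueness. Boundedness of ⟨x, f_k⟩ψ(x) is required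
because L^p convergence is tested only against bounded weights, p = 1 being allowed. -/
theorem HasSobolevGrad.integral_eq (hμ : IsCenteredGaussian Q μ) {p : ℝ≥0∞} (hp : 1 ≤ p)
    {u : H → ℝ} {G : H → H} (hG : HasSobolevGrad μ f Qhalf p u G) {k : ℕ} (hk : 1 ≤ k)
    {ψ : H → ℝ} (hψ : IsC1b ψ) (hψ' : ∃ C, ∀ x, |inner ℝ x (f k) * ψ x| ≤ C) :
    ∫ x, inner ℝ (G x) (f k) * ψ x ∂μ = √(eig k) *
      ((eig k)⁻¹ * ∫ x, u x * (inner ℝ x (f k) * ψ x) ∂μ - ∫ x, u x * fderiv ℝ ψ x (f k) ∂μ) := by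
  have := hμ.isGaussian
  obtain ⟨φ, hφ, h1, h2⟩ := hG.approx
  have hφ' := fun m => (hφ m).isC1b
  have hφL : ∀ m, MemLp (φ m) p μ := fun m => by
    obtain ⟨C, hC⟩ := (hφ' m).bdd
    exact MemLp.of_bound (hφ' m).continuous.aestronglyMeasurable C (Eventually.of_forall hC)
  have hgeq : ∀ m x, inner ℝ (Qhalf (gradient (φ m) x)) (f k) =
      √(eig k) * fderiv ℝ (φ m) x (f k) := fun m x => inner_Qhalf_gradient (φ m) hk x
  have hgL : ∀ m, MemLp (fun x => inner ℝ (Qhalf (gradient (φ m) x)) (f k)) p μ := fun m => by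
    simp only [hgeq]
    obtain ⟨C, hC⟩ := (hφ' m).bdd_fderiv_apply (f k)
    exact (MemLp.of_bound ((hφ' m).continuous_fderiv_apply _).aestronglyMeasurable C
      (Eventually.of_forall hC)).const_mul _
  have h2' : Tendsto (fun m => eLpNorm (fun x => inner ℝ (Qhalf (gradient (φ m) x)) (f k) -
      inner ℝ (G x) (f k)) p μ) atTop (𝓝 0) := by
    refine tendsto_of_tendsto_of_tendsto_of_le_of_le tendsto_const_nhds h2 (fun _ => zero_le)
      fun m => eLpNorm_mono fun x => ?_
    rw [← inner_sub_left]
    exact (norm_inner_le_norm _ _).trans (by rw [norm_f hk, mul_one])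
  have t1 := tendsto_integral_mul_of_eLpNorm hp hgL (hG.memLp_grad.inner_const (f k))
    hψ.continuous hψ.bdd h2'
  have t2 := tendsto_integral_mul_of_eLpNorm hp hφL hG.memLp
    (b := fun x => inner ℝ x (f k) * ψ x) (by have := hψ.continuous; fun_prop) hψ' h1
  have t3 := tendsto_integral_mul_of_eLpNorm hp hφL hG.memLp
    (hψ.continuous_fderiv_apply (f k)) (hψ.bdd_fderiv_apply (f k)) h1
  refine tendsto_nhds_unique t1 ?_
  refine (((t2.const_mul (eig k)⁻¹).sub t3).const_mul (√(eig k))).congr fun m => ?_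
  have ibp := integral_fderiv_f hμ hk ((hφ' m).mul hψ)
  have hd : ∀ x, fderiv ℝ (fun x => φ m x * ψ x) x (f k) =
      φ m x * fderiv ℝ ψ x (f k) + fderiv ℝ (φ m) x (f k) * ψ x := by
    intro x
    rw [fderiv_fun_mul (hφ' m).differentiable.differentiableAt
      hψ.differentiable.differentiableAt]
    simp [mul_comm]
  obtain ⟨C1, hC1⟩ := (hφ' m).bdd
  obtain ⟨C2, hC2⟩ := (hφ' m).bdd_fderiv_apply (f k)
  obtain ⟨C3, hC3⟩ := hψ.bdd
  obtain ⟨C4, hC4⟩ := hψ.bdd_fderiv_apply (f k)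
  have i1 : Integrable (fun x => φ m x * fderiv ℝ ψ x (f k)) μ :=
    ((hφL m).integrable hp).mul_bdd (c := C4) (hψ.continuous_fderiv_apply _).aestronglyMeasurable
      (Eventually.of_forall hC4)
  have i2 : Integrable (fun x => fderiv ℝ (φ m) x (f k) * ψ x) μ :=
    (Integrable.of_bound ((hφ' m).continuous_fderiv_apply (f k)).aestronglyMeasurable C2
      (Eventually.of_forall hC2)).mul_bdd (c := C3) hψ.continuous.aestronglyMeasurable
      (Eventually.of_forall hC3)
  simp only [hd] at ibp
  rw [integral_add i1 i2] at ibp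
  simp only [hgeq, mul_assoc (√(eig k))]
  rw [integral_const_mul]
  congr 1
  have e : ∀ x, φ m x * (inner ℝ x (f k) * ψ x) = inner ℝ x (f k) * (φ m x * ψ x) :=
    fun x => by ring
  simp only [e]
  rw [← ibp]
  ring

/-- The components of `Q^{1/2} Du` are uniquely determined by `u`. -/
theorem HasSobolevGrad.ae_unique (hμ : IsCenteredGaussian Q μ) {p : ℝ≥0∞} (hp : 1 ≤ p)
    {u : H → ℝ} {G G' : H → H} (hG : HasSobolevGrad μ f Qhalf p u G)
    (hG' : HasSobolevGrad μ f Qhalf p u G') {k : ℕ} (hk : 1 ≤ k) :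
    ∀ᵐ x ∂μ, inner ℝ (G x) (f k) = inner ℝ (G' x) (f k) := by
  have := hμ.isGaussian
  have hi : Integrable (fun x => inner ℝ (G x) (f k)) μ :=
    (hG.memLp_grad.inner_const (f k)).integrable hp
  have hi' : Integrable (fun x => inner ℝ (G' x) (f k)) μ :=
    (hG'.memLp_grad.inner_const (f k)).integrable hp
  -- This weight makes ⟨x, f_k⟩ψ(x) bounded, and being positive it can be cancelled at the end.
  have hcoord : IsC1b fun x : H => (1 + inner ℝ x (f k) ^ 2)⁻¹ := by
    have := isC1b_inv_one_add_sq.comp_clm (innerSL ℝ (f k))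
    simpa only [innerSL_apply_apply, real_inner_comm] using this
  have hle : ∀ s : ℝ, |s * (1 + s ^ 2)⁻¹| ≤ 1 := by
    intro s
    rw [abs_mul, abs_inv, abs_of_pos (by positivity : 0 < 1 + s ^ 2), ← div_eq_mul_inv,
      div_le_one (by positivity)]
    nlinarith [sq_nonneg (|s| - 1), sq_abs s, abs_nonneg s]
  have key : ∀ c : ℝ → ℝ, IsC1b c → (∀ s, |c s| ≤ 1) → ∀ t : H,
      ∫ x, (inner ℝ (G x) (f k) - inner ℝ (G' x) (f k)) * (1 + inner ℝ x (f k) ^ 2)⁻¹ *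
        c (inner ℝ x t) ∂μ = 0 := by
    intro c hc hc1 t
    have hct : IsC1b fun x : H => c (inner ℝ x t) := by
      have := hc.comp_clm (innerSL ℝ t)
      simpa only [innerSL_apply_apply, real_inner_comm] using this
    have hψ := hcoord.mul hct
    have hb : ∃ C, ∀ x : H, |inner ℝ x (f k) * ((1 + inner ℝ x (f k) ^ 2)⁻¹ * c (inner ℝ x t))|
        ≤ C := by
      refine ⟨1, fun x => ?_⟩
      rw [← mul_assoc, abs_mul]
      exact mul_le_one₀ (hle _) (abs_nonneg _) (hc1 _)
    obtain ⟨C, hC⟩ := hψ.bdd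
    have e1 := hG.integral_eq hμ hp hk hψ hb
    have e2 := hG'.integral_eq hμ hp hk hψ hb
    simp only [mul_assoc, sub_mul]
    rw [integral_sub, e1, e2, sub_self]
    · exact hi.mul_bdd (c := C) hψ.continuous.aestronglyMeasurable (Eventually.of_forall hC)
    · exact hi'.mul_bdd (c := C) hψ.continuous.aestronglyMeasurable (Eventually.of_forall hC)
  have hint : Integrable (fun x => (inner ℝ (G x) (f k) - inner ℝ (G' x) (f k)) *
      (1 + inner ℝ x (f k) ^ 2)⁻¹) μ := by
    obtain ⟨C, hC⟩ := hcoord.bdd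
    exact (hi.sub hi').mul_bdd (c := C) hcoord.continuous.aestronglyMeasurable
      (Eventually.of_forall hC)
  filter_upwards [ae_eq_zero_of_integral_cos_sin hint (key _ isC1b_cos Real.abs_cos_le_one)
    (key _ isC1b_sin Real.abs_sin_le_one)] with x hx
  have hpos : (1 + inner ℝ x (f k) ^ 2)⁻¹ ≠ 0 := by positivity
  exact sub_eq_zero.1 ((mul_eq_zero.1 hx).resolve_right hpos)

end IBP

/-! ### Growth of the potential -/

/-- A single natural exponent for Φ and Φ' avoids real powers later. The bound on Φ follows from
that on Φ' by the mean value inequality on the ball of radius |t|. -/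
theorem IsPotential.exists_growth {Φ : ℝ → ℝ} {C p₂ : ℝ} (h : IsPotential Φ C p₂) :
    ∃ (A : ℝ) (N : ℕ), N ≠ 0 ∧ 0 ≤ A ∧ (∀ t, |Φ t| ≤ A * (1 + |t| ^ N)) ∧
      ∀ t, |deriv Φ t| ≤ A * (1 + |t| ^ N) := by
  obtain ⟨M, hM⟩ := exists_nat_ge p₂
  have hC := h.C_pos
  have hp2 : 0 ≤ p₂ := by linarith [h.one_le]
  have hd : ∀ t, |deriv Φ t| ≤ C * (2 + |t| ^ M) := by
    intro t
    refine (h.growth t).trans (mul_le_mul_of_nonneg_left ?_ hC.le)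
    rcases le_total |t| 1 with ht | ht
    · have := Real.rpow_le_one (abs_nonneg t) ht hp2
      have : 0 ≤ |t| ^ M := by positivity
      linarith
    · have := Real.rpow_le_rpow_of_exponent_le ht hM
      rw [Real.rpow_natCast] at this
      linarith
  have hpow : ∀ t : ℝ, ∀ j : ℕ, j ≤ M + 1 → |t| ^ j ≤ 1 + |t| ^ (M + 1) := by
    intro t j hj
    rcases le_total |t| 1 with ht | ht
    · have := pow_le_one₀ (n := j) (abs_nonneg t) ht
      have : 0 ≤ |t| ^ (M + 1) := by positivity
      linarith
    · have := pow_le_pow_right₀ ht hj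
      linarith
  have hdiff : Differentiable ℝ Φ := h.contDiff.differentiable one_ne_zero
  -- From C(2 + |t|^M)|t| = 2C|t| + C|t|^(M+1) and |t| ≤ 1 + |t|^(M+1) one gets 2C + 3C|t|^(M+1), so
  -- 4C is enough; the bound for Φ' needs only 3C.
  refine ⟨|Φ 0| + 4 * C, M + 1, by omega, by positivity, fun t => ?_, fun t => ?_⟩
  · have hmv : |Φ t - Φ 0| ≤ C * (2 + |t| ^ M) * |t| := by
      have := Convex.norm_image_sub_le_of_norm_deriv_le (f := Φ) (s := Metric.closedBall 0 |t|)
        (x := 0) (y := t) (C := C * (2 + |t| ^ M)) (fun s _ => hdiff s) (fun s hs => ?_)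
        (convex_closedBall 0 |t|) (by simp) (by simp)
      · simpa using this
      · refine (hd s).trans ?_
        have hs' : |s| ≤ |t| := by simpa using hs
        gcongr
    have h1 := hpow t 1 (by omega)
    have h2 : (0 : ℝ) ≤ |t| ^ (M + 1) := by positivity
    have h3 : |Φ t| ≤ |Φ 0| + |Φ t - Φ 0| := by
      have := abs_add_le (Φ 0) (Φ t - Φ 0)
      rwa [add_sub_cancel] at this
    have h4 : C * (2 + |t| ^ M) * |t| = 2 * (C * |t|) + C * |t| ^ (M + 1) := by ring
    rw [pow_one] at h1
    have h5 := mul_le_mul_of_nonneg_left h1 hC.le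
    have h6 := mul_nonneg (abs_nonneg (Φ 0)) h2
    nlinarith [mul_nonneg hC.le h2]
  · have h1 := hpow t M (by omega)
    have h2 : (0 : ℝ) ≤ |t| ^ (M + 1) := by positivity
    have h5 := mul_le_mul_of_nonneg_left h1 hC.le
    have h6 := mul_nonneg (abs_nonneg (Φ 0)) h2
    have h7 := abs_nonneg (Φ 0)
    nlinarith [hd t, mul_nonneg hC.le h2]

/-! ### Truncation -/

/-- A smooth bounded truncation, equal to the identity for `ε = 0`. -/
noncomputable def trunc (ε t : ℝ) : ℝ := t / (1 + (ε * t) ^ 2)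

/-- The derivative of the truncation. -/
noncomputable def truncDeriv (ε t : ℝ) : ℝ := (1 - (ε * t) ^ 2) / (1 + (ε * t) ^ 2) ^ 2

theorem continuous_trunc : Continuous fun z : ℝ × ℝ => trunc z.1 z.2 :=
  continuous_snd.div (by fun_prop) fun z => by positivity

theorem continuous_truncDeriv : Continuous fun z : ℝ × ℝ => truncDeriv z.1 z.2 :=
  Continuous.div (by fun_prop) (by fun_prop) fun z => by positivity

theorem hasDerivAt_trunc (ε t : ℝ) : HasDerivAt (trunc ε) (truncDeriv ε t) t := by
  have h1 : HasDerivAt (fun t : ℝ => 1 + (ε * t) ^ 2) (2 * (ε * t) * ε) t := by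
    have := (((hasDerivAt_id t).const_mul ε).pow 2).const_add 1
    simpa using this
  have := (hasDerivAt_id t).div h1 (by positivity)
  convert! this using 1
  rw [truncDeriv]
  congr 1
  simp only [id]
  ring

theorem abs_trunc_le (ε t : ℝ) : |trunc ε t| ≤ |t| := by
  rw [trunc, abs_div, abs_of_pos (by positivity : 0 < 1 + (ε * t) ^ 2)]
  exact div_le_self (abs_nonneg _) (by nlinarith [sq_nonneg (ε * t)])

theorem abs_trunc_le_inv {ε : ℝ} (hε : 0 < ε) (t : ℝ) : |trunc ε t| ≤ ε⁻¹ := by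
  rw [trunc, abs_div, abs_of_pos (by positivity : 0 < 1 + (ε * t) ^ 2),
    div_le_iff₀ (by positivity), inv_mul_eq_div, le_div_iff₀ hε]
  have : |t| * ε = |ε * t| := by rw [abs_mul, abs_of_pos hε, mul_comm]
  rw [this, ← sq_abs]
  nlinarith [sq_nonneg (|ε * t| - 1), sq_nonneg |ε * t|]

theorem abs_truncDeriv_le (ε t : ℝ) : |truncDeriv ε t| ≤ 1 := by
  rw [truncDeriv, abs_div, abs_of_pos (by positivity : 0 < (1 + (ε * t) ^ 2) ^ 2),
    div_le_one (by positivity), abs_le]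
  constructor <;> nlinarith [sq_nonneg (ε * t), sq_nonneg ((ε * t) ^ 2)]

theorem trunc_zero (t : ℝ) : trunc 0 t = t := by simp [trunc]

theorem truncDeriv_zero (t : ℝ) : truncDeriv 0 t = 1 := by simp [truncDeriv]

section Truncation

variable {Φ : ℝ → ℝ}

theorem hasDerivAt_comp_trunc (hΦ : ContDiff ℝ 1 Φ) (ε t : ℝ) :
    HasDerivAt (fun t => Φ (trunc ε t)) (deriv Φ (trunc ε t) * truncDeriv ε t) t :=
  ((hΦ.differentiable one_ne_zero).differentiableAt.hasDerivAt).comp t (hasDerivAt_trunc ε t)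

theorem continuous_deriv_comp_trunc (hΦ : ContDiff ℝ 1 Φ) :
    Continuous fun z : ℝ × ℝ => deriv Φ (trunc z.1 z.2) * truncDeriv z.1 z.2 :=
  ((hΦ.continuous_deriv le_rfl).comp continuous_trunc).mul continuous_truncDeriv

/-- The truncation takes values in [-1/ε, 1/ε], where Φ and Φ' are bounded by compactness. -/
theorem isC1b_comp_trunc (hΦ : ContDiff ℝ 1 Φ) {ε : ℝ} (hε : 0 < ε) :
    IsC1b fun t => Φ (trunc ε t) := by
  have hd : deriv (fun t => Φ (trunc ε t)) = fun t => deriv Φ (trunc ε t) * truncDeriv ε t :=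
    funext fun t => (hasDerivAt_comp_trunc hΦ ε t).deriv
  have hK : ∀ t, trunc ε t ∈ Icc (-ε⁻¹) ε⁻¹ := fun t => abs_le.1 (abs_trunc_le_inv hε t)
  obtain ⟨C, hC⟩ := isCompact_Icc.exists_bound_of_continuousOn (s := Icc (-ε⁻¹) ε⁻¹)
    hΦ.continuous.continuousOn
  obtain ⟨C', hC'⟩ := isCompact_Icc.exists_bound_of_continuousOn (s := Icc (-ε⁻¹) ε⁻¹)
    (hΦ.continuous_deriv le_rfl).continuousOn
  refine isC1b_real (contDiff_one_iff_deriv.2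
    ⟨fun t => (hasDerivAt_comp_trunc hΦ ε t).differentiableAt, ?_⟩) ⟨C, fun t => hC _ (hK t)⟩
    ⟨C', fun t => ?_⟩
  · rw [hd]
    exact (continuous_deriv_comp_trunc hΦ).comp (f := fun t => (ε, t)) (by fun_prop)
  · rw [hd, abs_mul]
    exact (mul_le_of_le_one_right (abs_nonneg _) (abs_truncDeriv_le _ _)).trans (hC' _ (hK t))

/-- The truncation parameters. -/
noncomputable def truncParam (m : ℕ) : ℝ := 1 / ((m : ℝ) + 1)

theorem truncParam_pos (m : ℕ) : 0 < truncParam m := Nat.one_div_pos_of_nat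

/-- Joint continuity up to ε = 0 yields the convergence with moving argument that
`tendsto_eLpNorm_comp` asks for. -/
theorem tendsto_truncParam {K : ℝ × ℝ → ℝ} (hK : Continuous K) (t : ℝ) :
    Tendsto (fun p : ℕ × ℝ => K (truncParam p.1, p.2)) (atTop ×ˢ 𝓝 t) (𝓝 (K (0, t))) := by
  have h1 : Tendsto truncParam atTop (𝓝 0) := tendsto_one_div_add_atTop_nhds_zero_nat
  have h2 : Tendsto (fun p : ℕ × ℝ => (truncParam p.1, p.2)) (atTop ×ˢ 𝓝 t) (𝓝 (0, t)) :=
    (h1.comp tendsto_fst).prodMk_nhds tendsto_snd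
  exact (hK.tendsto (0, t)).comp h2

end Truncation

/-! ### Cylindrical integral functionals -/

section IntegralFunctional

variable {E : Type*} [NormedAddCommGroup E] [NormedSpace ℝ E] {F : ℝ → ℝ} {L : ℝ → E →L[ℝ] ℝ}

/-- Here `L ξ` stands for evaluation of the partial sum at ξ. The space `E` is general because it is
ℝⁿ when checking the cylindrical class and `H` when computing the derivative. -/
theorem hasFDerivAt_integral_comp (hF : IsC1b F) (hL : Continuous L) (y : E) :
    HasFDerivAt (fun y => ∫ ξ, F (L ξ y) ∂vol01) (∫ ξ, deriv F (L ξ y) • L ξ ∂vol01) y := by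
  obtain ⟨C, hC⟩ := hF.bdd_fderiv
  have hFc := hF.continuous
  have hFd : Continuous (deriv F) := hF.contDiff.continuous_deriv le_rfl
  have hLy : ∀ y, Continuous fun ξ => L ξ y := fun y => hL.clm_apply continuous_const
  refine hasFDerivAt_integral_of_dominated_of_fderiv_le (s := univ)
    (F' := fun y ξ => deriv F (L ξ y) • L ξ) (bound := fun ξ => C * ‖L ξ‖) univ_mem
    (Eventually.of_forall fun y => (hFc.comp (hLy y)).aestronglyMeasurable)
    (integrable_of_continuous (hFc.comp (hLy y)))
    ((hFd.comp (hLy y)).smul hL).aestronglyMeasurable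
    (Eventually.of_forall fun ξ y _ => ?_)
    (integrable_of_continuous (continuous_const.mul hL.norm))
    (Eventually.of_forall fun ξ y _ => ?_)
  · rw [norm_smul, norm_deriv_eq_norm_fderiv]
    exact mul_le_mul_of_nonneg_right (hC _) (norm_nonneg _)
  · exact (hF.differentiable.differentiableAt.hasDerivAt).comp_hasFDerivAt y (L ξ).hasFDerivAt

theorem isC1b_integral_comp (hF : IsC1b F) (hL : Continuous L) :
    IsC1b fun y => ∫ ξ, F (L ξ y) ∂vol01 := by
  obtain ⟨C₀, hC₀⟩ := hF.bdd
  obtain ⟨C, hC⟩ := hF.bdd_fderiv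
  have hFd : Continuous (deriv F) := hF.contDiff.continuous_deriv le_rfl
  have hfd : fderiv ℝ (fun y => ∫ ξ, F (L ξ y) ∂vol01) =
      fun y => ∫ ξ, deriv F (L ξ y) • L ξ ∂vol01 :=
    funext fun y => (hasFDerivAt_integral_comp hF hL y).fderiv
  have hbd : ∀ y ξ, ‖deriv F (L ξ y) • L ξ‖ ≤ C * ‖L ξ‖ := fun y ξ => by
    rw [norm_smul, norm_deriv_eq_norm_fderiv]
    exact mul_le_mul_of_nonneg_right (hC _) (norm_nonneg _)
  have hbi : Integrable (fun ξ => C * ‖L ξ‖) vol01 :=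
    integrable_of_continuous (continuous_const.mul hL.norm)
  refine ⟨contDiff_one_iff_fderiv.2
    ⟨fun y => (hasFDerivAt_integral_comp hF hL y).differentiableAt, ?_⟩, ⟨C₀, fun y => ?_⟩,
    ⟨∫ ξ, C * ‖L ξ‖ ∂vol01, fun y => ?_⟩⟩
  · rw [hfd]
    refine continuous_of_dominated (bound := fun ξ => C * ‖L ξ‖) (fun y => ?_)
      (fun y => Eventually.of_forall (hbd y)) hbi (Eventually.of_forall fun ξ => ?_)
    · exact ((hFd.comp (hL.clm_apply continuous_const)).smul hL).aestronglyMeasurable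
    · exact (hFd.comp (L ξ).continuous).smul continuous_const
  · have := norm_integral_le_of_norm_le_const (μ := vol01) (f := fun ξ => F (L ξ y))
      (Eventually.of_forall fun ξ => hC₀ _)
    simpa using this
  · rw [hfd]
    exact norm_integral_le_of_norm_le hbi (Eventually.of_forall (hbd y))

end IntegralFunctional

/-- The functional `x ↦ ∫ F(P_n x(ξ)) dξ`. -/
noncomputable def cylFunctional (F : ℝ → ℝ) (n : ℕ) (x : H) : ℝ :=
  ∫ ξ, F (partialField n (x, ξ)) ∂vol01

section CylFunctional

variable {F : ℝ → ℝ}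

theorem isCylindrical_cylFunctional (hF : IsC1b F) (n : ℕ) :
    IsCylindrical f (cylFunctional F n) := by
  have hc := continuous_fFun
  let L : ℝ → (Fin n → ℝ) →L[ℝ] ℝ := fun ξ =>
    ∑ i : Fin n, fFun (i + 1) ξ • ContinuousLinearMap.proj (R := ℝ) (φ := fun _ : Fin n => ℝ) i
  have hL : Continuous L := by
    refine continuous_finsetSum _ fun i _ => ?_
    exact (hc (i + 1)).smul continuous_const
  have h := isC1b_integral_comp hF hL
  refine ⟨n, _, h.contDiff, h.bdd, h.bdd_fderiv, ?_⟩
  ext x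
  rw [cylFunctional]
  congr 1
  ext ξ
  congr 1
  have hI : Finset.Icc 1 n = (Finset.range n).image (fun i => i + 1) := by
    ext k
    simp only [Finset.mem_Icc, Finset.mem_image, Finset.mem_range]
    constructor
    · intro h; exact ⟨k - 1, by omega, by omega⟩
    · rintro ⟨a, h, rfl⟩; omega
  rw [partialField, hI, Finset.sum_image (by intro a _ b _ h; simpa using h),
    Finset.sum_range (fun i => inner ℝ x (f (i + 1)) * fFun (i + 1) ξ)]
  simp [L, mul_comm]

theorem fderiv_cylFunctional (hF : IsC1b F) (n : ℕ) (x : H) {k : ℕ} (hk : 1 ≤ k) :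
    fderiv ℝ (cylFunctional F n) x (f k) =
      if k ≤ n then ∫ ξ, deriv F (partialField n (x, ξ)) * fFun k ξ ∂vol01 else 0 := by
  have hc := continuous_fFun
  let L : ℝ → H →L[ℝ] ℝ := fun ξ => ∑ k ∈ Finset.Icc 1 n, fFun k ξ • innerSL ℝ (f k)
  have hL : Continuous L := by
    refine continuous_finsetSum _ fun i _ => ?_
    exact (hc i).smul continuous_const
  have hLx : ∀ ξ x, L ξ x = partialField n (x, ξ) := by
    intro ξ x
    simp [L, partialField, real_inner_comm, mul_comm]
  have h := (hasFDerivAt_integral_comp hF hL x).fderiv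
  simp only [hLx] at h
  have hFd : Continuous (deriv F) := hF.contDiff.continuous_deriv le_rfl
  have hpc : Continuous fun ξ => partialField n (x, ξ) :=
    (continuous_partialField n).comp (by fun_prop)
  have hint : Integrable (fun ξ => deriv F (partialField n (x, ξ)) • L ξ) vol01 := by
    obtain ⟨C, hC⟩ := isCompact_Icc.exists_bound_of_continuousOn (s := Icc (0 : ℝ) 1)
      ((hFd.comp hpc).smul hL).continuousOn
    exact Integrable.of_bound ((hFd.comp hpc).smul hL).aestronglyMeasurable C
      ((ae_restrict_iff' measurableSet_Ioo).2
        (Eventually.of_forall fun ξ hξ => hC ξ (Ioo_subset_Icc_self hξ)))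
  change fderiv ℝ (fun x => ∫ ξ, F (partialField n (x, ξ)) ∂vol01) x (f k) = _
  rw [h, ContinuousLinearMap.integral_apply hint]
  have hPf : ∀ ξ, partialField n (f k, ξ) = if k ≤ n then fFun k ξ else 0 := by
    intro ξ
    have : ∀ j ∈ Finset.Icc 1 n, inner ℝ (f k) (f j) * fFun j ξ = if k = j then fFun j ξ else 0 := by
      intro j hj
      rw [inner_f_f hk (Finset.mem_Icc.1 hj).1]
      simp
    simp only [partialField]
    rw [Finset.sum_congr rfl this, Finset.sum_ite_eq]
    simp [hk]
  simp only [_root_.smul_apply, hLx, hPf, smul_eq_mul]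
  split_ifs <;> simp

/-- Compare coordinates: √λ_k ∫ F' f_k and ⟨F'/√2, f_k⟩ agree since √λ_k = 1/(√2 (kπ)²). In this
closed form, differences of gradients are controlled by L²(0,1) norms of differences of F'. -/
theorem Qhalf_gradient_cylFunctional (hF : IsC1b F) (n : ℕ) (x : H)
    (hm : MemLp (fun ξ => deriv F (partialField n (x, ξ))) 2 vol01) :
    Qhalf (gradient (cylFunctional F n) x) = P n ((√2)⁻¹ • ofL2 hm.toLp) := by
  refine eq_of_inner_f_eq fun k hk => ?_
  rw [inner_Qhalf_gradient _ hk, fderiv_cylFunctional hF n x hk, inner_P_f hk,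
    real_inner_smul_left, inner_ofL2_f _ hk,
    integral_congr_ae (f := fun ξ => (hm.toLp : ℝ → ℝ) ξ * fFun k ξ)
      (g := fun ξ => deriv F (partialField n (x, ξ)) * fFun k ξ)
      (by filter_upwards [hm.coeFn_toLp] with ξ hξ; rw [hξ]), sqrt_eig]
  split_ifs <;> ring

end CylFunctional

/-! ### Measurability, projection and change of exponent for `H`-valued functions. -/

theorem continuous_P (n : ℕ) : Continuous (P n) := by
  unfold P; fun_prop

/-- A limit of finite sums. It is applied to `gradU`, which is defined by cases and has accessible
coordinates. -/
theorem aestronglyMeasurable_of_inner_f {μ : Measure H} {G : H → H}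
    (h : ∀ k, 1 ≤ k → AEStronglyMeasurable (fun x => inner ℝ (G x) (f k)) μ) :
    AEStronglyMeasurable G μ := by
  refine aestronglyMeasurable_of_tendsto_ae atTop (f := fun n x => P n (G x)) (fun n => ?_)
    (Eventually.of_forall fun x => tendsto_P (G x))
  simp only [P]
  refine Finset.aestronglyMeasurable_fun_sum _ fun k hk => ?_
  exact (h k (Finset.mem_Icc.1 hk).1).smul_const _

/-- Dominated convergence with majorant (2‖G‖)^q, as P_n is a contraction tending strongly to the
identity. -/
theorem tendsto_eLpNorm_P_sub {μ : Measure H} {q : ℝ≥0∞} (hq0 : q ≠ 0) (hq : q ≠ ⊤) {G : H → H}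
    (hG : MemLp G q μ) : Tendsto (fun n => eLpNorm (fun x => P n (G x) - G x) q μ) atTop (𝓝 0) := by
  have hq' : 0 < q.toReal := ENNReal.toReal_pos hq0 hq
  have hlim : Tendsto (fun n => ∫⁻ x, ‖P n (G x) - G x‖ₑ ^ q.toReal ∂μ) atTop
      (𝓝 (∫⁻ _, 0 ∂μ)) := by
    refine tendsto_lintegral_of_dominated_convergence' (fun x => (2 * ‖G x‖ₑ) ^ q.toReal)
      (fun n => ?_) (fun n => Eventually.of_forall fun x => ?_) ?_
      (Eventually.of_forall fun x => ?_)
    · exact (((continuous_P n).comp_aestronglyMeasurable hG.1).sub hG.1).enorm.pow_const _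
    · refine ENNReal.rpow_le_rpow ((enorm_sub_le).trans ?_) hq'.le
      rw [two_mul]
      gcongr
      rw [← ofReal_norm, ← ofReal_norm]
      exact ENNReal.ofReal_le_ofReal (norm_P_le n _)
    · simp only [ENNReal.mul_rpow_of_nonneg _ _ hq'.le]
      rw [lintegral_const_mul' _ _ (by finiteness)]
      exact ENNReal.mul_ne_top (by finiteness)
        ((eLpNorm_lt_top_iff_lintegral_rpow_enorm_lt_top hq0 hq).1 hG.2).ne
    · have h1 : Tendsto (fun n => ‖P n (G x) - G x‖ₑ) atTop (𝓝 0) := by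
        have := (continuous_enorm.tendsto (0 : H)).comp
          (tendsto_sub_nhds_zero_iff.2 (tendsto_P (G x)))
        simpa [Function.comp_def] using this
      have := (ENNReal.continuous_rpow_const (y := q.toReal)).tendsto 0 |>.comp h1
      simpa [ENNReal.zero_rpow_of_pos hq', Function.comp_def] using this
  rw [lintegral_zero] at hlim
  have := (ENNReal.continuous_rpow_const (y := 1 / q.toReal)).tendsto 0 |>.comp hlim
  rw [ENNReal.zero_rpow_of_pos (by positivity)] at this
  refine this.congr fun n => ?_
  rw [eLpNorm_eq_lintegral_rpow_enorm_toReal hq0 hq]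
  rfl

theorem HasSobolevGrad.mono {μ : Measure H} [IsProbabilityMeasure μ] {p q : ℝ≥0∞} (hpq : p ≤ q)
    {u : H → ℝ} {G : H → H} (h : HasSobolevGrad μ f Qhalf q u G) :
    HasSobolevGrad μ f Qhalf p u G := by
  obtain ⟨φ, hφ, h1, h2⟩ := h.approx
  refine ⟨h.memLp.mono_exponent hpq, h.memLp_grad.mono_exponent hpq, φ, hφ, ?_, ?_⟩
  · refine tendsto_of_tendsto_of_tendsto_of_le_of_le tendsto_const_nhds h1 (fun _ => zero_le)
      fun m => eLpNorm_le_eLpNorm_of_exponent_le hpq ?_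
    exact (hφ m).isC1b.continuous.aestronglyMeasurable.sub h.memLp.1
  · refine tendsto_of_tendsto_of_tendsto_of_le_of_le tendsto_const_nhds h2 (fun _ => zero_le)
      fun m => eLpNorm_le_eLpNorm_of_exponent_le hpq ?_
    have hgc : Continuous (gradient (φ m)) :=
      (InnerProductSpace.toDual ℝ H).symm.continuous.comp
        ((hφ m).isC1b.contDiff.continuous_fderiv one_ne_zero)
    exact (Qhalf.continuous.comp hgc).aestronglyMeasurable.sub h.memLp_grad.1

/-! ### The potential on the Gaussian space -/

section Potential

variable {μ : Measure H} {Φ : ℝ → ℝ} {C p₂ : ℝ} {S : H × ℝ → ℝ}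

theorem eLpNorm_integral_sub_le [IsProbabilityMeasure μ] {q : ℕ} (hq : 1 ≤ q)
    {g h : H × ℝ → ℝ} (hg : MemLp g q (μ.prod vol01)) (hh : MemLp h q (μ.prod vol01)) :
    eLpNorm (fun x => ∫ ξ, g (x, ξ) ∂vol01 - ∫ ξ, h (x, ξ) ∂vol01) q μ ≤
      eLpNorm (fun z => g z - h z) q (μ.prod vol01) := by
  have hq' : (1 : ℝ≥0∞) ≤ q := by exact_mod_cast hq
  refine le_trans (le_of_eq ?_)
    (eLpNorm_integral_le (hg.sub hh).1 hq' (ENNReal.natCast_ne_top q))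
  refine eLpNorm_congr_ae ?_
  filter_upwards [MemLp.ae_memLp_prodMk (by positivity) (ENNReal.natCast_ne_top q) hg,
    MemLp.ae_memLp_prodMk (by positivity) (ENNReal.natCast_ne_top q) hh] with x h1 h2
  exact (integral_sub (h1.integrable hq') (h2.integrable hq')).symm

theorem memLp_integral [IsProbabilityMeasure μ] {q : ℕ} (hq : 1 ≤ q)
    {g : H × ℝ → ℝ} (hg : MemLp g q (μ.prod vol01)) :
    MemLp (fun x => ∫ ξ, g (x, ξ) ∂vol01) q μ :=
  ⟨hg.1.integral_prod_right', (eLpNorm_integral_le hg.1 (by exact_mod_cast hq)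
    (ENNReal.natCast_ne_top q)).trans_lt hg.2⟩

theorem memLp_partialField_all (hμ : IsCenteredGaussian Q μ) (n q : ℕ) :
    MemLp (partialField n) q (μ.prod vol01) := by
  rcases Nat.eq_zero_or_pos q with rfl | hq
  · simpa using (continuous_partialField n).aestronglyMeasurable
  · exact memLp_partialField hμ q hq n

theorem IsField.ae_U_eq (hS : IsField μ S) (hμ : IsCenteredGaussian Q μ) (hp : 0 ≤ p₂)
    (Φ : ℝ → ℝ) :
    ∀ᵐ x ∂μ, U Φ p₂ x = ((∫ ξ, Φ (S (x, ξ)) ∂vol01 : ℝ) : EReal) := by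
  obtain ⟨M, hM⟩ := exists_nat_ge (p₂ + 1)
  filter_upwards [hS.ae_represents hμ] with x hx
  have hM1 : 1 ≤ M := by
    have : (1 : ℝ) ≤ M := by linarith
    exact_mod_cast this
  refine U_eq_of_represents hp ((hx M hM1).mono ?_)
  rw [← ENNReal.ofReal_natCast]
  exact ENNReal.ofReal_le_ofReal hM

theorem IsField.tendsto_eLpNorm_Un_sub (hS : IsField μ S) (hμ : IsCenteredGaussian Q μ)
    (hΦ : IsPotential Φ C p₂) {q : ℕ} (hq : 1 ≤ q) :
    Tendsto (fun n => eLpNorm (fun x => Un Φ n x - ∫ ξ, Φ (S (x, ξ)) ∂vol01) q μ)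
      atTop (𝓝 0) := by
  have := hμ.isGaussian
  obtain ⟨A, N, hN, hA, hg, -⟩ := hΦ.exists_growth
  have hc := hΦ.contDiff.continuous
  have h1 := tendsto_eLpNorm_comp (F := fun _ => Φ) (F' := Φ)
    (fun n => (continuous_partialField n).aestronglyMeasurable) (eLpNorm_partialField_le hμ)
    hS.memLp hS.tendstoInMeasure (fun _ => hc) hc hN hA (fun _ => hg) hg
    (fun t => (hc.tendsto t).comp tendsto_snd) hq
  refine tendsto_of_tendsto_of_tendsto_of_le_of_le tendsto_const_nhds h1 (fun _ => zero_le)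
    fun n => ?_
  exact eLpNorm_integral_sub_le (g := fun z => Φ (partialField n z)) (h := fun z => Φ (S z)) hq
    (memLp_comp (memLp_partialField_all hμ n) hc hN hA hg hq)
    (memLp_comp hS.memLp hc hN hA hg hq)

theorem memLp_Un (hμ : IsCenteredGaussian Q μ) (hΦ : IsPotential Φ C p₂) {q : ℕ} (hq : 1 ≤ q)
    (n : ℕ) : MemLp (Un Φ n) q μ := by
  have := hμ.isGaussian
  obtain ⟨A, N, hN, hA, hg, -⟩ := hΦ.exists_growth
  exact memLp_integral hq
    (memLp_comp (memLp_partialField_all hμ n) hΦ.contDiff.continuous hN hA hg hq)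

open Classical in
/-- The function `x ↦ ofL2 (Φ' ∘ x) / √2`, which is `Q^{1/2} DU`. -/
noncomputable def gradU (Φ : ℝ → ℝ) (S : H × ℝ → ℝ) (x : H) : H :=
  if h : MemLp (fun ξ => deriv Φ (S (x, ξ))) 2 vol01 then (√2)⁻¹ • ofL2 h.toLp else 0

theorem IsField.memLp_deriv (hS : IsField μ S) [IsProbabilityMeasure μ] (hΦ : IsPotential Φ C p₂)
    {q : ℕ} (hq : 1 ≤ q) : MemLp (fun z => deriv Φ (S z)) q (μ.prod vol01) := by
  obtain ⟨A, N, hN, hA, -, hg⟩ := hΦ.exists_growth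
  exact memLp_comp hS.memLp (hΦ.contDiff.continuous_deriv le_rfl) hN hA hg hq

theorem IsField.ae_memLp_deriv (hS : IsField μ S) [IsProbabilityMeasure μ]
    (hΦ : IsPotential Φ C p₂) :
    ∀ᵐ x ∂μ, MemLp (fun ξ => deriv Φ (S (x, ξ))) 2 vol01 := by
  simpa using MemLp.ae_memLp_prodMk (by norm_num) (by norm_num)
    (hS.memLp_deriv hΦ (q := 2) (by norm_num))

theorem inner_gradU {x : H} (hx : MemLp (fun ξ => deriv Φ (S (x, ξ))) 2 vol01) {k : ℕ}
    (hk : 1 ≤ k) : inner ℝ (gradU Φ S x) (f k) =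
      √(eig k) * ∫ ξ, deriv Φ (S (x, ξ)) * fFun k ξ ∂vol01 := by
  rw [gradU, dif_pos hx, real_inner_smul_left, inner_ofL2_f _ hk,
    integral_congr_ae (f := fun ξ => (hx.toLp : ℝ → ℝ) ξ * fFun k ξ)
      (g := fun ξ => deriv Φ (S (x, ξ)) * fFun k ξ)
      (by filter_upwards [hx.coeFn_toLp] with ξ hξ; rw [hξ]), sqrt_eig, mul_assoc]

theorem enorm_smul_ofL2_le (g : L2) :
    ‖(√2)⁻¹ • ofL2 g‖ₑ ≤ (‖(√2)⁻¹‖ₑ * ‖ofL2‖ₑ) * eLpNorm g 2 vol01 := by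
  rw [enorm_smul, mul_assoc, ← Lp.enorm_def]
  gcongr
  exact ofL2.le_opENorm g

/-- The bound on `ofL2` uses the L²(0,1) norm of each section; q ≥ 2 lets the L^q norm dominate it.
-/
theorem IsField.memLp_gradU (hS : IsField μ S) [IsProbabilityMeasure μ]
    (hΦ : IsPotential Φ C p₂) {q : ℕ} (hq : 2 ≤ q) : MemLp (gradU Φ S) q μ := by
  have hd := hS.memLp_deriv hΦ (q := q) (by omega)
  have hdc := hΦ.contDiff.continuous_deriv le_rfl
  refine ⟨aestronglyMeasurable_of_inner_f fun k hk => ?_, ?_⟩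
  · have hm : AEStronglyMeasurable
        (fun x => √(eig k) * ∫ ξ, deriv Φ (S (x, ξ)) * fFun k ξ ∂vol01) μ := by
      refine AEStronglyMeasurable.const_mul ?_ _
      exact ((hdc.comp_stronglyMeasurable hS.stronglyMeasurable).mul
        ((continuous_fFun k).comp continuous_snd).stronglyMeasurable).integral_prod_right'.aestronglyMeasurable
    refine hm.congr ?_
    filter_upwards [hS.ae_memLp_deriv hΦ] with x hx
    exact (inner_gradU hx hk).symm
  · have hcst : ‖(√2)⁻¹‖ₑ * ‖ofL2‖ₑ ≠ ⊤ := by finiteness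
    refine (eLpNorm_le_eLpNorm_prod hd.1 (by positivity) (ENNReal.natCast_ne_top q) hcst
      ?_).trans_lt (ENNReal.mul_lt_top hcst.lt_top hd.2)
    filter_upwards [hS.ae_memLp_deriv hΦ] with x hx
    rw [gradU, dif_pos hx]
    refine (enorm_smul_ofL2_le _).trans ?_
    rw [eLpNorm_congr_ae hx.coeFn_toLp]
    gcongr
    exact eLpNorm_le_eLpNorm_of_exponent_le (by exact_mod_cast hq) hx.1

/-- The approximants are diagonal: truncation parameter 1/(m+1) together with projection P_m.
Truncation increases neither |t| nor the size of derivatives, so the growth bounds hold uniformly in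
m. -/
theorem IsField.hasSobolevGrad (hS : IsField μ S) (hμ : IsCenteredGaussian Q μ)
    (hΦ : IsPotential Φ C p₂) {q : ℕ} (hq : 2 ≤ q) :
    HasSobolevGrad μ f Qhalf q (fun x => ∫ ξ, Φ (S (x, ξ)) ∂vol01) (gradU Φ S) := by
  have := hμ.isGaussian
  have hq1 : 1 ≤ q := by omega
  obtain ⟨A, N, hN, hA, hg, hg'⟩ := hΦ.exists_growth
  have hc := hΦ.contDiff.continuous
  have hdc := hΦ.contDiff.continuous_deriv le_rfl
  set Fm : ℕ → ℝ → ℝ := fun m t => Φ (trunc (truncParam m) t) with hFm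
  have hF : ∀ m, IsC1b (Fm m) := fun m => isC1b_comp_trunc hΦ.contDiff (truncParam_pos m)
  have hFd : ∀ m, deriv (Fm m) = fun t => deriv Φ (trunc (truncParam m) t) *
      truncDeriv (truncParam m) t :=
    fun m => funext fun t => (hasDerivAt_comp_trunc hΦ.contDiff _ t).deriv
  have hmono : ∀ ε t : ℝ, A * (1 + |trunc ε t| ^ N) ≤ A * (1 + |t| ^ N) := fun ε t => by
    have := abs_trunc_le ε t
    gcongr
  have hFb : ∀ m t, |Fm m t| ≤ A * (1 + |t| ^ N) := fun m t => (hg _).trans (hmono _ _)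
  have hFdb : ∀ m t, |deriv (Fm m) t| ≤ A * (1 + |t| ^ N) := fun m t => by
    rw [hFd, abs_mul]
    exact (mul_le_of_le_one_right (abs_nonneg _) (abs_truncDeriv_le _ _)).trans
      ((hg' _).trans (hmono _ _))
  have hFdc : ∀ m, Continuous (deriv (Fm m)) := fun m => (hF m).contDiff.continuous_deriv le_rfl
  have hcv : ∀ t, Tendsto (fun p : ℕ × ℝ => Fm p.1 p.2) (atTop ×ˢ 𝓝 t) (𝓝 (Φ t)) := fun t => by
    have := tendsto_truncParam (hc.comp continuous_trunc) t
    simpa only [Function.comp_apply, trunc_zero] using this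
  have hcvd : ∀ t, Tendsto (fun p : ℕ × ℝ => deriv (Fm p.1) p.2) (atTop ×ˢ 𝓝 t)
      (𝓝 (deriv Φ t)) := fun t => by
    have := tendsto_truncParam (continuous_deriv_comp_trunc hΦ.contDiff) t
    simpa only [hFd, trunc_zero, truncDeriv_zero, mul_one] using this
  have hmeas := fun n => (continuous_partialField n).aestronglyMeasurable (μ := μ.prod vol01)
  have t1 := tendsto_eLpNorm_comp hmeas (eLpNorm_partialField_le hμ) hS.memLp
    hS.tendstoInMeasure (fun m => (hF m).continuous) hc hN hA hFb hg hcv hq1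
  have t2 := tendsto_eLpNorm_comp hmeas (eLpNorm_partialField_le hμ) hS.memLp
    hS.tendstoInMeasure hFdc hdc hN hA hFdb hg' hcvd hq1
  have hGL := hS.memLp_gradU hΦ hq
  refine ⟨memLp_integral hq1 (memLp_comp hS.memLp hc hN hA hg hq1), hGL,
    fun m => cylFunctional (Fm m) m, fun m => isCylindrical_cylFunctional (hF m) m, ?_, ?_⟩
  · refine tendsto_of_tendsto_of_tendsto_of_le_of_le tendsto_const_nhds t1 (fun _ => zero_le)
      fun m => ?_
    exact eLpNorm_integral_sub_le (g := fun z => Fm m (partialField m z))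
      (h := fun z => Φ (S z)) hq1
      (memLp_comp (memLp_partialField_all hμ m) (hF m).continuous hN hA (hFb m) hq1)
      (memLp_comp hS.memLp hc hN hA hg hq1)
  · have hq' : (1 : ℝ≥0∞) ≤ q := by exact_mod_cast hq1
    have hcst : ‖(√2)⁻¹‖ₑ * ‖ofL2‖ₑ ≠ ⊤ := by finiteness
    have t3 := ENNReal.Tendsto.const_mul (a := ‖(√2)⁻¹‖ₑ * ‖ofL2‖ₑ) t2 (Or.inr hcst)
    have t4 := t3.add (tendsto_eLpNorm_P_sub (by positivity) (ENNReal.natCast_ne_top q) hGL)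
    rw [mul_zero, add_zero] at t4
    refine tendsto_of_tendsto_of_tendsto_of_le_of_le tendsto_const_nhds t4 (fun _ => zero_le)
      fun m => ?_
    have hPc : ∀ x, Continuous fun ξ => partialField m (x, ξ) := fun x =>
      (continuous_partialField m).comp (by fun_prop)
    have hml : ∀ x, MemLp (fun ξ => deriv (Fm m) (partialField m (x, ξ))) 2 vol01 :=
      fun x => memLp_of_continuous ((hFdc m).comp (hPc x)) 2
    -- The first term is P_m of a difference of gradients, controlled by the convergence of the
    -- derivatives; the second is the projection error of the limit.
    have hsplit : (fun x => Qhalf (gradient (cylFunctional (Fm m) m) x) - gradU Φ S x) =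
        (fun x => Qhalf (gradient (cylFunctional (Fm m) m) x) - P m (gradU Φ S x)) +
          fun x => P m (gradU Φ S x) - gradU Φ S x := by
      ext1 x; simp
    have hgc : Continuous fun x => Qhalf (gradient (cylFunctional (Fm m) m) x) :=
      Qhalf.continuous.comp ((InnerProductSpace.toDual ℝ H).symm.continuous.comp
        ((isCylindrical_cylFunctional (hF m) m).isC1b.contDiff.continuous_fderiv one_ne_zero))
    have hPG := (continuous_P m).comp_aestronglyMeasurable hGL.1
    rw [hsplit]
    refine (eLpNorm_add_le (hgc.aestronglyMeasurable.sub hPG) (hPG.sub hGL.1) hq').trans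
      (add_le_add_left ?_ _)
    have hmd := (memLp_comp (memLp_partialField_all hμ m) (hFdc m) hN hA (hFdb m) hq1).sub
      (hS.memLp_deriv hΦ hq1)
    refine eLpNorm_le_eLpNorm_prod hmd.1 (by positivity) (ENNReal.natCast_ne_top q) hcst ?_
    filter_upwards [hS.ae_memLp_deriv hΦ] with x hx
    have e : Qhalf (gradient (cylFunctional (Fm m) m) x) - P m (gradU Φ S x) =
        P m ((√2)⁻¹ • ofL2 ((hml x).toLp - hx.toLp)) := by
      rw [Qhalf_gradient_cylFunctional (hF m) m x (hml x), gradU, dif_pos hx, ← P_sub, map_sub,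
        smul_sub]
    rw [Pi.sub_apply, e]
    have hP : ‖P m ((√2)⁻¹ • ofL2 ((hml x).toLp - hx.toLp))‖ₑ ≤
        ‖(√2)⁻¹ • ofL2 ((hml x).toLp - hx.toLp)‖ₑ := by
      rw [← ofReal_norm, ← ofReal_norm]
      exact ENNReal.ofReal_le_ofReal (norm_P_le m _)
    refine (hP.trans (enorm_smul_ofL2_le _)).trans ?_
    gcongr
    rw [← MemLp.toLp_sub, eLpNorm_congr_ae ((hml x).sub hx).coeFn_toLp]
    exact eLpNorm_le_eLpNorm_of_exponent_le (by exact_mod_cast hq) ((hml x).sub hx).1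

theorem HasSobolevGrad.congr {p : ℝ≥0∞} {u u' : H → ℝ} {G : H → H}
    (h : HasSobolevGrad μ f Qhalf p u G) (hu : u =ᵐ[μ] u') :
    HasSobolevGrad μ f Qhalf p u' G := by
  obtain ⟨φ, hφ, h1, h2⟩ := h.approx
  refine ⟨h.memLp.ae_eq hu, h.memLp_grad, φ, hφ, h1.congr fun m => eLpNorm_congr_ae ?_, h2⟩
  filter_upwards [hu] with x hx
  rw [hx]

theorem IsField.ae_deriv_toFun (hS : IsField μ S) (hμ : IsCenteredGaussian Q μ) (Φ : ℝ → ℝ)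
    (k : ℕ) : ∀ᵐ x ∂μ, (fun ξ => deriv Φ (toFun x ξ) * fFun k ξ) =ᵐ[vol01]
      fun ξ => deriv Φ (S (x, ξ)) * fFun k ξ := by
  filter_upwards [hS.ae_represents hμ] with x hx
  filter_upwards [toFun_ae_eq (by simpa using hx 1 le_rfl)] with ξ hξ
  rw [hξ]

end Potential

end CahnHilliard

/-! ### The main statement. -/

theorem proposition6p4 (μ : Measure CahnHilliard.H)
    (hμ : CahnHilliard.IsCenteredGaussian CahnHilliard.Q μ)
    (Φ : ℝ → ℝ) (C p₂ : ℝ) (hΦ : CahnHilliard.IsPotential Φ C p₂) :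
    -- `U` is finite almost everywhere, and `U ∘ P_n = U_n` is finite everywhere
    (∀ᵐ x ∂μ, CahnHilliard.U Φ p₂ x ≠ ⊤) ∧
    (∀ (n : ℕ) (x : CahnHilliard.H),
      CahnHilliard.U Φ p₂ (CahnHilliard.P n x) = (CahnHilliard.Un Φ n x : EReal)) ∧
    (∀ p : ENNReal, 1 ≤ p → p ≠ ⊤ →
      CahnHilliard.MemW μ p (fun x => (CahnHilliard.U Φ p₂ x).toReal) ∧
      (∀ n : ℕ, MemLp (CahnHilliard.Un Φ n) p μ) ∧
      Tendsto (fun n : ℕ =>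
          eLpNorm (fun x => CahnHilliard.Un Φ n x - (CahnHilliard.U Φ p₂ x).toReal) p μ)
        atTop (𝓝 0) ∧
      ∀ k : ℕ, 1 ≤ k →
        CahnHilliard.IsPartialDeriv μ p (fun x => (CahnHilliard.U Φ p₂ x).toReal) k
          (fun x => ∫ ξ, deriv Φ (CahnHilliard.toFun x ξ) * CahnHilliard.fFun k ξ
            ∂CahnHilliard.vol01)) ∧
    (∀ k : ℕ, 1 ≤ k → ∀ᵐ x ∂μ,
      Integrable (fun ξ => deriv Φ (CahnHilliard.toFun x ξ) * CahnHilliard.fFun k ξ)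
        CahnHilliard.vol01) := by
  have := hμ.isGaussian
  obtain ⟨S, hS⟩ := CahnHilliard.exists_isField hμ
  have hp2 : 0 ≤ p₂ := by linarith [hΦ.one_le]
  have hU := hS.ae_U_eq hμ hp2 Φ
  have hUr : ∀ᵐ x ∂μ, ∫ ξ, Φ (S (x, ξ)) ∂CahnHilliard.vol01 =
      (CahnHilliard.U Φ p₂ x).toReal := by
    filter_upwards [hU] with x hx
    rw [hx, EReal.toReal_coe]
  have hD := fun k => hS.ae_deriv_toFun hμ Φ k
  refine ⟨?_, fun n x => CahnHilliard.U_P Φ hp2 n x, fun p hp1 hp => ?_, fun k _ => ?_⟩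
  · filter_upwards [hU] with x hx
    rw [hx]
    exact EReal.coe_ne_top _
  · obtain ⟨q₀, hq₀⟩ := ENNReal.exists_nat_gt hp
    -- As μ is a probability measure, a natural exponent q ≥ max(2, p) suffices.
    obtain ⟨q, hq2, hpq⟩ : ∃ q : ℕ, 2 ≤ q ∧ p ≤ q :=
      ⟨q₀ + 2, by omega, hq₀.le.trans (by exact_mod_cast Nat.le_add_right q₀ 2)⟩
    have hgrad := ((hS.hasSobolevGrad hμ hΦ hq2).mono hpq).congr hUr
    refine ⟨⟨_, hgrad⟩, fun n => (CahnHilliard.memLp_Un hμ hΦ (by omega) n).mono_exponent hpq,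
      ?_, fun k hk => ⟨⟨_, hgrad⟩, fun G hG => ?_⟩⟩
    · refine tendsto_of_tendsto_of_tendsto_of_le_of_le tendsto_const_nhds
        (hS.tendsto_eLpNorm_Un_sub hμ hΦ (q := q) (by omega)) (fun _ => zero_le) fun n => ?_
      rw [eLpNorm_congr_ae (g := fun x => CahnHilliard.Un Φ n x -
        ∫ ξ, Φ (S (x, ξ)) ∂CahnHilliard.vol01) (by filter_upwards [hUr] with x hx; rw [hx])]
      exact eLpNorm_le_eLpNorm_of_exponent_le hpq
        ((CahnHilliard.memLp_Un hμ hΦ (q := q) (by omega) n).1.sub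
          (hS.hasSobolevGrad hμ hΦ hq2).memLp.1)
    -- An arbitrary version `G` is first replaced by `gradU`, whose coordinates are explicit.
    · filter_upwards [hG.ae_unique hμ hp1 hgrad hk, hD k, hS.ae_memLp_deriv hΦ] with x h1 h2 h3
      rw [h1, CahnHilliard.inner_gradU h3 hk, integral_congr_ae h2, ← mul_assoc,
        inv_mul_cancel₀ (CahnHilliard.sqrt_eig_pos hk).ne', one_mul]
  · filter_upwards [hD k, hS.ae_memLp_deriv hΦ] with x h1 h2
    exact (CahnHilliard.integrable_continuous_mul (h2.integrable (by norm_num))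
      (CahnHilliard.continuous_fFun k)).congr h1.symm
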